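/- Let an \emph{ebit} be the two-qubit state $|\Phi^+\rangle=\frac1{\sqrt2}(|00\rangle+|11\rangle)$ shared between two parties, Alice and Bob. An \emph{LOBC protocol} (local operations and broadcast communication) on two qubits $A$ (Alice) and $B$ (Bob) that consumes $n$ ebits consists of local measurements with finitely many Kraus operators $A_a$ (Alice) and $B_b$ (Bob), each party acting on its own qubit and its own halves of the $n$ ebits and leaving one qubit, $\sum_a A_a^\dagger A_a=\mathbb I$, $\sum_b B_b^\dagger B_b=\mathbb I$, and of local unitaries $W_{ab}$, $V_{ab}$ on the remaining two qubits, which are applied after the outcomes $a$ and $b$ have been broadcast. Let $K_{ab}|\psi\rangle=(W_{ab}A_a\otimes V_{ab}B_b)(|\psi\rangle\otimes|\Phi^+\rangle^{\otimes n})$. The protocol implements the channel $\mathcal E(\rho)=\sum_{a,b}K_{ab}\rho K_{ab}^\dagger$. It performs the unitary $U$ with success probability $p$ if there is a set $S$ of outcome pairs such that $K_{ab}$ is a scalar multiple of $U$ for all $(a,b)\in S$, and such that on every input state the outcome pair lies in $S$ with probability $p$. \textbf{Theorem 2.} Let $U$ be any two-qubit unitary and $\mathcal U(\rho)=U\rho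 U^\dagger$. (1) For every integer $N\ge 0$, with $p_N=(1-2^{-N})^3$ and $\epsilon_N=2(1-p_N)$, there is an LOBC protocol that consumes $8N+1$ ebits and performs $U$ with success probability $p_N$; on failure the two qubits can be replaced with white noise, so that the protocol implements the channel $$\mathcal E(\rho)=p_N\,U\rho U^\dagger+(1-p_N)\,\mathrm{tr}(\rho)\,\frac{\mathbb I\otimes\mathbb I}{4},$$ and it then satisfies $\|\mathcal E-\mathcal U\|_\diamond\le\epsilon_N$, where $8N+1\le 8\log_2(1/\epsilon_N)+22$. (2) Consequently, error $\epsilon$ in diamond norm is reached with $O(\log(1/\epsilon))$ ebits: for every $0<\epsilon\le 2$ there is an LOBC protocol that consumes at most $8\log_2(1/\epsilon)+30$ ebits and implements a channel $\mathcal E$ with $\|\mathcal E-\mathcal U\|_\diamond\le\epsilon$. -/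

import Mathlib

open scoped Matrix Kronecker ComplexOrder

noncomputable section

/-- The state space of one qubit has the index set `Qubit`; two qubits, one at Alice and one at
Bob, have the index set `Qubit × Qubit` (Alice first). -/
abbrev Qubit : Type := Fin 2

/-- Computational basis labels of one party's halves of `n` ebits. -/
abbrev Halves (n : ℕ) : Type := Fin n → Qubit

/-- Amplitudes of the ebit `|Φ⁺⟩ = (|00⟩ + |11⟩) / √2`. -/
def ebitAmp (i j : Qubit) : ℂ := if i = j then 1 / (Real.sqrt 2 : ℂ) else 0

/-- Amplitudes of `n` ebits, the `k`-th one shared between Alice's `k`-th and Bob's `k`-th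
half. -/
def ebitsAmp (n : ℕ) (s t : Halves n) : ℂ := ∏ k, ebitAmp (s k) (t k)

/-- The isometry `|ψ⟩ ↦ |ψ⟩ ⊗ |Φ⁺⟩^{⊗n}`, with the systems reordered so that Alice's qubit comes
with Alice's halves and Bob's qubit comes with Bob's halves. -/
def appendEbits (n : ℕ) :
    Matrix ((Qubit × Halves n) × (Qubit × Halves n)) (Qubit × Qubit) ℂ :=
  Matrix.of fun x y =>
    if x.1.1 = y.1 ∧ x.2.1 = y.2 then ebitsAmp n x.1.2 x.2.2 else 0

/-- An LOBC protocol on two qubits that consumes `n` ebits and no other entanglement.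
Alice and Bob each perform one local measurement (with Kraus operators `A a` and `B b`) on their
own qubit and their own halves of the ebits; no message is exchanged before that. Then they
broadcast the outcomes `a`, `b` and apply local unitaries `W a b`, `V a b`. -/
structure LOBCProtocol (n : ℕ) where
  OutA : Type
  OutB : Type
  [fintypeA : Fintype OutA]
  [fintypeB : Fintype OutB]
  A : OutA → Matrix Qubit (Qubit × Halves n) ℂ
  B : OutB → Matrix Qubit (Qubit × Halves n) ℂ
  complete_A : ∑ a, (A a)ᴴ * A a = 1
  complete_B : ∑ b, (B b)ᴴ * B b = 1
  W : OutA → OutB → Matrix.unitaryGroup Qubit ℂ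
  V : OutA → OutB → Matrix.unitaryGroup Qubit ℂ

attribute [instance] LOBCProtocol.fintypeA LOBCProtocol.fintypeB

/-- Density operators: positive semidefinite with trace one. -/
def IsDensity {ι : Type*} [Fintype ι] (ρ : Matrix ι ι ℂ) : Prop :=
  ρ.PosSemidef ∧ ρ.trace = 1

namespace LOBCProtocol

variable {n : ℕ} (P : LOBCProtocol n)

/-- The operator that maps the two-qubit input to the unnormalized final state of the two qubits
for the outcomes `a`, `b`: `|ψ⟩ ↦ (W a b * A a ⊗ V a b * B b) (|ψ⟩ ⊗ |Φ⁺⟩^{⊗n})`. -/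
def kraus (a : P.OutA) (b : P.OutB) : Matrix (Qubit × Qubit) (Qubit × Qubit) ℂ :=
  (((P.W a b : Matrix Qubit Qubit ℂ) * P.A a) ⊗ₖ ((P.V a b : Matrix Qubit Qubit ℂ) * P.B b)) *
    appendEbits n

/-- The probability of the outcomes `a`, `b` on the input state `ρ`. -/
def prob (ρ : Matrix (Qubit × Qubit) (Qubit × Qubit) ℂ) (a : P.OutA) (b : P.OutB) : ℝ :=
  (P.kraus a b * ρ * (P.kraus a b)ᴴ).trace.re

/-- The protocol performs `U` with success probability `p`: there is a set `S` of outcome pairs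
(the successes, known to both parties after the broadcast) such that on `S` the final state is
exactly `U|ψ⟩`, up to the amplitude of the outcome, for every input `|ψ⟩`, and such that on every
input state the probability of `S` is `p`. -/
def PerformsWithProb (U : Matrix (Qubit × Qubit) (Qubit × Qubit) ℂ) (p : ℝ) : Prop :=
  ∃ S : Finset (P.OutA × P.OutB),
    (∀ o ∈ S, ∃ c : ℂ, P.kraus o.1 o.2 = c • U) ∧
    ∀ ρ : Matrix (Qubit × Qubit) (Qubit × Qubit) ℂ, IsDensity ρ →
      ∑ o ∈ S, P.prob ρ o.1 o.2 = p

/-- The quantum channel on two qubits that the protocol implements (average over all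
outcomes). -/
def channel : Matrix (Qubit × Qubit) (Qubit × Qubit) ℂ →ₗ[ℂ]
    Matrix (Qubit × Qubit) (Qubit × Qubit) ℂ where
  toFun ρ := ∑ a, ∑ b, P.kraus a b * ρ * (P.kraus a b)ᴴ
  map_add' ρ σ := by
    simp only [Matrix.mul_add, Matrix.add_mul, Finset.sum_add_distrib]
  map_smul' c ρ := by
    simp only [Matrix.mul_smul, Matrix.smul_mul, Finset.smul_sum, RingHom.id_apply]

end LOBCProtocol

/-- The channel `ρ ↦ U ρ U†`. -/
def unitaryChannel {ι : Type*} [Fintype ι] (U : Matrix ι ι ℂ) :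
    Matrix ι ι ℂ →ₗ[ℂ] Matrix ι ι ℂ where
  toFun ρ := U * ρ * Uᴴ
  map_add' ρ σ := by simp only [Matrix.mul_add, Matrix.add_mul]
  map_smul' c ρ := by simp only [Matrix.mul_smul, Matrix.smul_mul, RingHom.id_apply]

/-- The channel `ρ ↦ tr(ρ) (𝕀 ⊗ 𝕀) / 4` that replaces a two-qubit state with white noise. -/
def whiteNoise : Matrix (Qubit × Qubit) (Qubit × Qubit) ℂ →ₗ[ℂ]
    Matrix (Qubit × Qubit) (Qubit × Qubit) ℂ where
  toFun ρ := (ρ.trace / 4) • (1 : Matrix (Qubit × Qubit) (Qubit × Qubit) ℂ)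
  map_add' ρ σ := by rw [Matrix.trace_add, add_div, add_smul]
  map_smul' c ρ := by
    rw [Matrix.trace_smul, smul_eq_mul, mul_div_assoc, mul_smul, RingHom.id_apply]

/-- The trace norm: the sum of the singular values (square roots of the eigenvalues of
`Xᴴ * X`). -/
def traceNorm {ι : Type*} [Fintype ι] [DecidableEq ι] (X : Matrix ι ι ℂ) : ℝ :=
  ∑ i, Real.sqrt ((Matrix.isHermitian_conjTranspose_mul_self X).eigenvalues i)

/-- `Φ ⊗ id` with a `k`-dimensional reference system: `Φ` acts on each block of `X`. -/
def tensorId {ι : Type*} (Φ : Matrix ι ι ℂ →ₗ[ℂ] Matrix ι ι ℂ) (k : ℕ)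
    (X : Matrix (ι × Fin k) (ι × Fin k) ℂ) : Matrix (ι × Fin k) (ι × Fin k) ℂ :=
  Matrix.of fun x y => Φ (Matrix.of fun i j => X (i, x.2) (j, y.2)) x.1 y.1

/-- The diamond norm: the supremum, over reference systems of every finite dimension, of the trace
norm of `(Φ ⊗ id) X` over the `X` of trace norm at most one. The supremum is taken in `[0, ∞]`. -/
def diamondNorm {ι : Type*} [Fintype ι] [DecidableEq ι]
    (Φ : Matrix ι ι ℂ →ₗ[ℂ] Matrix ι ι ℂ) : ENNReal :=
  ⨆ (k : ℕ) (X : Matrix (ι × Fin k) (ι × Fin k) ℂ) (_ : traceNorm X ≤ 1),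
    ENNReal.ofReal (traceNorm (tensorId Φ k X))

/-- The success probability `(1 - 2^{-N})³`. -/
def successProb (N : ℕ) : ℝ := (1 - (1 / 2 : ℝ) ^ N) ^ 3

end

/-! By the canonical decomposition, `U` is, up to a phase and local unitaries on both sides, a
product of the gates exp(iγ Y⊗Y), exp(iβ X⊗X) and exp(iα Z⊗Z). So it is enough to perform such gates
without communication, up to local unitaries that can be undone after the broadcast.

One ebit gives one attempt at exp(iβ P⊗P). Alice's parity measurement copies the P-value of her
qubit to Bob's half up to a random sign m, and Bob rotates his qubit controlled by that half. This
yields exp(±iβ P⊗P) with equal probability, up to the byproduct P⊗1. Alice knows whether the sign is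
right; if not, the missing gate is the same one with the angle doubled. Bob cannot know, so he
doubles his angle every time; once an attempt has succeeded, Alice measures her halves so that Bob's
later rotations do nothing but the identity or 1⊗P. Thus N attempts fail with probability 2^{-N}
(`exists_attempts`).

A byproduct P commutes with its own gate, but it anticommutes with the other two Pauli matrices and
flips the angles of the gates still to come. This flip is the xor of a bit known to Alice and a bit
known to Bob. It costs nothing: Alice redefines which outcome counts as right and Bob changes the
sign of his angle. Three gates in sequence give probability (1 - 2^{-N})³
(`exists_achieves_canonical`).

The canonical decomposition comes from the magic basis, in which local unitaries are essentially the
real rotations and the canonical gates are diagonal. There it becomes the factorization of a unitary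
as orthogonal times diagonal times orthogonal.

On failure a Pauli twirl by private randomness produces white noise (`Achieves.exists_protocol`).
The channel then differs from that of `U` by (1 - p) times a difference of two maps that do not
increase the trace norm, hence the error 2(1 - p) ≤ 6·2^{-N}. -/

/-! ### Trace norm: duality with contractions. -/

section TraceNorm

variable {ι : Type*} [Fintype ι] [DecidableEq ι]

/-- The right singular basis of a matrix: `X * Q` has orthogonal columns. -/
theorem exists_unitary_diagonal_gram (X : Matrix ι ι ℂ) :
    ∃ Q ∈ Matrix.unitaryGroup ι ℂ, (X * Q)ᴴ * (X * Q) = Matrix.diagonal fun i =>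
      (((Matrix.isHermitian_conjTranspose_mul_self X).eigenvalues i : ℝ) : ℂ) := by
  set hX := Matrix.isHermitian_conjTranspose_mul_self X
  refine ⟨hX.eigenvectorUnitary, hX.eigenvectorUnitary.2, ?_⟩
  have h := hX.conjStarAlgAut_star_eigenvectorUnitary
  rw [Unitary.conjStarAlgAut_star_apply] at h
  rw [Matrix.conjTranspose_mul, Matrix.mul_assoc, ← Matrix.mul_assoc Xᴴ, ← Matrix.mul_assoc]
  exact h

/-- In the right singular basis the columns of `X` have the singular values as norms, while the rows
of the contraction have norm at most one; Cauchy–Schwarz bounds each diagonal entry of the product.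
-/
theorem re_trace_mul_le_traceNorm (X V : Matrix ι ι ℂ)
    (hV : (1 - V * Vᴴ).PosSemidef) : (V * X).trace.re ≤ traceNorm X := by
  obtain ⟨Q, hQ, hY⟩ := exists_unitary_diagonal_gram X
  set Y := X * Q with hYdef
  set R := Qᴴ * V with hRdef
  have hQ1 : Q * Qᴴ = 1 := (Matrix.mem_unitaryGroup_iff).1 hQ
  have hQ2 : Qᴴ * Q = 1 := (Matrix.mem_unitaryGroup_iff').1 hQ
  have htr : (V * X).trace = (R * Y).trace := by
    rw [hRdef, hYdef, Matrix.mul_assoc, Matrix.trace_mul_comm Qᴴ, Matrix.mul_assoc,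
      Matrix.mul_assoc, hQ1, Matrix.mul_one]
  have hR : ∀ i, ∑ j, ‖R i j‖ ^ 2 ≤ 1 := by
    intro i
    have h1 := (hV.conjTranspose_mul_mul_same Q).diag_nonneg (i := i)
    have h2 : Qᴴ * (1 - V * Vᴴ) * Q = 1 - R * Rᴴ := by
      rw [hRdef, Matrix.conjTranspose_mul, Matrix.conjTranspose_conjTranspose, Matrix.mul_sub,
        Matrix.sub_mul, Matrix.mul_one, hQ2]
      simp only [Matrix.mul_assoc]
    rw [h2, Matrix.sub_apply, Matrix.one_apply_eq, Matrix.mul_apply] at h1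
    have h3 : ∑ j, R i j * Rᴴ j i = ((∑ j, ‖R i j‖ ^ 2 : ℝ) : ℂ) := by
      push_cast
      refine Finset.sum_congr rfl fun j _ => ?_
      rw [Matrix.conjTranspose_apply]
      exact Complex.mul_conj' _
    rw [h3] at h1
    have := (Complex.le_def.1 h1).1
    rw [Complex.sub_re, Complex.one_re, Complex.ofReal_re, Complex.zero_re] at this
    linarith
  have hYn : ∀ i, ∑ j, ‖Y j i‖ ^ 2 =
      (Matrix.isHermitian_conjTranspose_mul_self X).eigenvalues i := by
    intro i
    have h1 := congrFun (congrFun hY i) i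
    rw [Matrix.diagonal_apply_eq, Matrix.mul_apply] at h1
    have h3 : ∑ j, Yᴴ i j * Y j i = ((∑ j, ‖Y j i‖ ^ 2 : ℝ) : ℂ) := by
      push_cast
      refine Finset.sum_congr rfl fun j _ => ?_
      rw [Matrix.conjTranspose_apply]
      exact Complex.conj_mul' _
    rw [h3] at h1
    exact_mod_cast h1
  rw [htr, Matrix.trace, Complex.re_sum, traceNorm]
  refine Finset.sum_le_sum fun i _ => ?_
  rw [Matrix.diag_apply, Matrix.mul_apply]
  calc (∑ j, R i j * Y j i).re ≤ ‖∑ j, R i j * Y j i‖ := Complex.re_le_norm _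
    _ ≤ ∑ j, ‖R i j‖ * ‖Y j i‖ := (norm_sum_le _ _).trans (by simp)
    _ ≤ √(∑ j, ‖R i j‖ ^ 2) * √(∑ j, ‖Y j i‖ ^ 2) := Real.sum_mul_le_sqrt_mul_sqrt _ _ _
    _ ≤ 1 * √(∑ j, ‖Y j i‖ ^ 2) := by
        gcongr
        exact Real.sqrt_le_one.2 (hR i)
    _ = _ := by rw [one_mul, hYn]

/-- The polar decomposition provides the optimal contraction. With the previous bound, the trace
norm is a maximum of linear functionals, which makes the norm inequalities below immediate. -/
theorem exists_re_trace_mul_eq_traceNorm (X : Matrix ι ι ℂ) :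
    ∃ V : Matrix ι ι ℂ, (1 - V * Vᴴ).PosSemidef ∧ (V * X).trace.re = traceNorm X := by
  obtain ⟨Q, hQ, hY⟩ := exists_unitary_diagonal_gram X
  set Y := X * Q with hYdef
  set l := (Matrix.isHermitian_conjTranspose_mul_self X).eigenvalues with hl
  have hl0 : ∀ i, 0 ≤ l i := Matrix.eigenvalues_conjTranspose_mul_self_nonneg X
  have hQ1 : Q * Qᴴ = 1 := (Matrix.mem_unitaryGroup_iff).1 hQ
  -- The convention 0⁻¹ = 0 makes this the pseudo-inverse, so that `R` is a partial isometry
  -- vanishing on null singular directions.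
  set d : ι → ℂ := fun i => (((√(l i))⁻¹ : ℝ) : ℂ) with hd
  set R := Matrix.diagonal d * Yᴴ with hR
  have hdl : ∀ i, d i * (l i : ℂ) = ((√(l i) : ℝ) : ℂ) := by
    intro i
    rw [hd, ← Complex.ofReal_mul]
    congr 1
    rcases eq_or_ne (l i) 0 with h | h
    · simp [h]
    · have := Real.sqrt_ne_zero'.2 (lt_of_le_of_ne (hl0 i) h.symm)
      nth_rw 2 [← Real.mul_self_sqrt (hl0 i)]
      rw [inv_mul_cancel_left₀ this]
  have hRY : R * Y = Matrix.diagonal fun i => ((√(l i) : ℝ) : ℂ) := by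
    rw [hR, Matrix.mul_assoc, hY, Matrix.diagonal_mul_diagonal]
    simp only [hdl]
  have hRR : R * Rᴴ = Matrix.diagonal fun i => ((√(l i) * (√(l i))⁻¹ : ℝ) : ℂ) := by
    have : Rᴴ = Y * Matrix.diagonal d := by
      rw [hR, Matrix.conjTranspose_mul, Matrix.conjTranspose_conjTranspose,
        Matrix.diagonal_conjTranspose]
      congr 2
      funext i
      simp [hd]
    rw [this, ← Matrix.mul_assoc, hRY, Matrix.diagonal_mul_diagonal]
    simp [hd]
  refine ⟨Q * R, ?_, ?_⟩
  · have h1 : 1 - Q * R * (Q * R)ᴴ = Q * (1 - R * Rᴴ) * Qᴴ := by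
      rw [Matrix.conjTranspose_mul, Matrix.mul_sub, Matrix.sub_mul, Matrix.mul_one, hQ1]
      simp only [Matrix.mul_assoc]
    rw [h1]
    refine Matrix.PosSemidef.mul_mul_conjTranspose_same ?_ Q
    rw [hRR, ← Matrix.diagonal_one, Matrix.diagonal_sub]
    refine Matrix.posSemidef_diagonal_iff.2 fun i => ?_
    rw [← Complex.ofReal_one, ← Complex.ofReal_sub]
    exact Complex.zero_le_real.2 (sub_nonneg.2 mul_inv_le_one)
  · rw [Matrix.mul_assoc, Matrix.trace_mul_comm, Matrix.mul_assoc, ← hYdef, hRY,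
      Matrix.trace_diagonal, Complex.re_sum]
    simp [traceNorm, hl]

theorem traceNorm_add_le (X Y : Matrix ι ι ℂ) :
    traceNorm (X + Y) ≤ traceNorm X + traceNorm Y := by
  obtain ⟨V, hV, h⟩ := exists_re_trace_mul_eq_traceNorm (X + Y)
  rw [← h, Matrix.mul_add, Matrix.trace_add, Complex.add_re]
  exact add_le_add (re_trace_mul_le_traceNorm X V hV) (re_trace_mul_le_traceNorm Y V hV)

theorem traceNorm_sum_le {κ : Type*} (s : Finset κ) (X : κ → Matrix ι ι ℂ) :
    traceNorm (∑ k ∈ s, X k) ≤ ∑ k ∈ s, traceNorm (X k) := by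
  classical
  induction s using Finset.induction_on with
  | empty =>
    obtain ⟨V, hV, h⟩ := exists_re_trace_mul_eq_traceNorm (0 : Matrix ι ι ℂ)
    simp [← h]
  | insert k s hk ih =>
    rw [Finset.sum_insert hk, Finset.sum_insert hk]
    exact (traceNorm_add_le _ _).trans (by gcongr)

theorem traceNorm_smul_le {r : ℝ} (hr : 0 ≤ r) (X : Matrix ι ι ℂ) :
    traceNorm ((r : ℂ) • X) ≤ r * traceNorm X := by
  obtain ⟨V, hV, h⟩ := exists_re_trace_mul_eq_traceNorm ((r : ℂ) • X)
  rw [← h, Matrix.mul_smul, Matrix.trace_smul, smul_eq_mul, Complex.re_ofReal_mul]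
  exact mul_le_mul_of_nonneg_left (re_trace_mul_le_traceNorm X V hV) hr

theorem traceNorm_neg_le (X : Matrix ι ι ℂ) : traceNorm (-X) ≤ traceNorm X := by
  obtain ⟨V, hV, h⟩ := exists_re_trace_mul_eq_traceNorm (-X)
  rw [← h, Matrix.mul_neg, ← Matrix.neg_mul]
  exact re_trace_mul_le_traceNorm X (-V) (by simpa using hV)

theorem traceNorm_unitary_conj_le {W : Matrix ι ι ℂ} (hW : W ∈ Matrix.unitaryGroup ι ℂ)
    (X : Matrix ι ι ℂ) : traceNorm (W * X * Wᴴ) ≤ traceNorm X := by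
  obtain ⟨V, hV, h⟩ := exists_re_trace_mul_eq_traceNorm (W * X * Wᴴ)
  have hW1 : W * Wᴴ = 1 := (Matrix.mem_unitaryGroup_iff).1 hW
  have hW2 : Wᴴ * W = 1 := (Matrix.mem_unitaryGroup_iff').1 hW
  have h1 : (V * (W * X * Wᴴ)).trace = (Wᴴ * V * W * X).trace := by
    rw [Matrix.mul_assoc W, ← Matrix.mul_assoc V, ← Matrix.mul_assoc (V * W),
      Matrix.trace_mul_comm]
    simp only [Matrix.mul_assoc]
  rw [← h, h1]
  refine re_trace_mul_le_traceNorm X _ ?_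
  have h2 : 1 - Wᴴ * V * W * (Wᴴ * V * W)ᴴ = Wᴴ * (1 - V * Vᴴ) * W := by
    rw [Matrix.conjTranspose_mul, Matrix.conjTranspose_mul, Matrix.conjTranspose_conjTranspose,
      Matrix.mul_sub, Matrix.sub_mul, Matrix.mul_one, hW2]
    congr 1
    rw [Matrix.mul_assoc _ W, ← Matrix.mul_assoc W, hW1, Matrix.one_mul]
    simp only [Matrix.mul_assoc]
  rw [h2]
  exact hV.conjTranspose_mul_mul_same W

end TraceNorm

/-! ### Pauli twirl. -/

section Twirl

/-- The four Pauli matrices (with a real matrix for the third one), which are unitary. -/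
def pauli : Fin 4 → Matrix Qubit Qubit ℂ :=
  ![1, !![0, 1; 1, 0], !![0, -1; 1, 0], !![1, 0; 0, -1]]

theorem pauli_mem_unitaryGroup (r : Fin 4) : pauli r ∈ Matrix.unitaryGroup Qubit ℂ := by
  rw [Matrix.mem_unitaryGroup_iff]
  ext i j
  fin_cases r <;> fin_cases i <;> fin_cases j <;>
    simp [pauli, Matrix.star_eq_conjTranspose, Matrix.mul_apply]

theorem kronecker_mul_mul_apply (P Q : Matrix Qubit Qubit ℂ)
    (X : Matrix (Qubit × Qubit) (Qubit × Qubit) ℂ) (x y : Qubit × Qubit) :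
    ((P ⊗ₖ Q) * X * (P ⊗ₖ Q)ᴴ) x y = ∑ i, ∑ j, ∑ k, ∑ l,
      P x.1 i * star (P y.1 k) * (Q x.2 j * star (Q y.2 l)) * X (i, j) (k, l) := by
  simp only [Matrix.mul_apply, Fintype.sum_prod_type, Matrix.conjTranspose_apply,
    Matrix.kroneckerMap_apply, star_mul', Fin.sum_univ_two]
  ring

/-- Completeness of the Pauli matrices as an orthogonal basis of the 2 × 2 matrices. -/
theorem sum_pauli_mul_star (a b i k : Qubit) :
    ∑ r, pauli r a i * star (pauli r b k) = if a = b ∧ i = k then 2 else 0 := by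
  fin_cases a <;> fin_cases b <;> fin_cases i <;> fin_cases k <;>
    simp [pauli, Fin.sum_univ_four] <;> norm_num

/-- Averaging over the Pauli matrices on both qubits replaces a state with white noise. -/
theorem pauli_twirl (X : Matrix (Qubit × Qubit) (Qubit × Qubit) ℂ) :
    ∑ r, ∑ s, (pauli r ⊗ₖ pauli s) * X * (pauli r ⊗ₖ pauli s)ᴴ = (16 : ℂ) • whiteNoise X := by
  ext x y
  have h : ∀ i j k l : Qubit, ∑ r, ∑ s,
      pauli r x.1 i * star (pauli r y.1 k) * (pauli s x.2 j * star (pauli s y.2 l)) *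
        X (i, j) (k, l) = (if x.1 = y.1 ∧ i = k then 2 else 0) * (if x.2 = y.2 ∧ j = l then 2 else 0) *
        X (i, j) (k, l) := by
    intro i j k l
    rw [← sum_pauli_mul_star x.1 y.1 i k, ← sum_pauli_mul_star x.2 y.2 j l,
      Finset.sum_mul_sum, Finset.sum_mul]
    simp only [Finset.sum_mul]
  have h2 : (∑ r, ∑ s, (pauli r ⊗ₖ pauli s) * X * (pauli r ⊗ₖ pauli s)ᴴ) x y =
      ∑ i, ∑ j, ∑ k, ∑ l, ∑ r, ∑ s,
      pauli r x.1 i * star (pauli r y.1 k) * (pauli s x.2 j * star (pauli s y.2 l)) *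
        X (i, j) (k, l) := by
    simp only [Matrix.sum_apply, kronecker_mul_mul_apply, Fin.sum_univ_two,
      Finset.sum_add_distrib]
  rw [h2]
  simp only [h]
  obtain ⟨x1, x2⟩ := x
  obtain ⟨y1, y2⟩ := y
  have hr : ((16 : ℂ) • whiteNoise X) (x1, x2) (y1, y2) =
      4 * (if x1 = y1 ∧ x2 = y2 then 1 else 0) * X.trace := by
    simp only [whiteNoise, LinearMap.coe_mk, AddHom.coe_mk, Matrix.smul_apply, Matrix.one_apply,
      Prod.mk.injEq, smul_eq_mul]
    ring
  rw [hr]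
  simp only [Fin.sum_univ_two, Matrix.trace, Matrix.diag, Fintype.sum_prod_type]
  by_cases h1 : x1 = y1 <;> by_cases h2 : x2 = y2 <;> simp [h1, h2]
  ring

end Twirl

/-! ### Diamond norm distance to a unitary mixed with white noise. -/

section Diamond

theorem tensorId_unitaryChannel {ι : Type*} [Fintype ι] (V : Matrix ι ι ℂ) (k : ℕ)
    (X : Matrix (ι × Fin k) (ι × Fin k) ℂ) :
    tensorId (unitaryChannel V) k X =
      (V ⊗ₖ (1 : Matrix (Fin k) (Fin k) ℂ)) * X * (V ⊗ₖ (1 : Matrix (Fin k) (Fin k) ℂ))ᴴ := by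
  ext x y
  simp only [tensorId, unitaryChannel, LinearMap.coe_mk, AddHom.coe_mk, Matrix.of_apply,
    Matrix.mul_apply, Matrix.conjTranspose_apply, Matrix.kroneckerMap_apply, Matrix.one_apply,
    Fintype.sum_prod_type, star_mul']
  simp

variable {ι : Type*} [Fintype ι] [DecidableEq ι]

theorem traceNorm_tensorId_unitaryChannel_le {V : Matrix ι ι ℂ}
    (hV : V ∈ Matrix.unitaryGroup ι ℂ) (k : ℕ) (X : Matrix (ι × Fin k) (ι × Fin k) ℂ) :
    traceNorm (tensorId (unitaryChannel V) k X) ≤ traceNorm X := by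
  rw [tensorId_unitaryChannel]
  exact traceNorm_unitary_conj_le (Matrix.kronecker_mem_unitary hV (one_mem _)) X

/-- White noise is a uniform mixture of 16 unitary channels, so its contractivity follows from
unitary invariance. -/
theorem tensorId_whiteNoise (k : ℕ)
    (X : Matrix ((Qubit × Qubit) × Fin k) ((Qubit × Qubit) × Fin k) ℂ) :
    tensorId whiteNoise k X = ((1 / 16 : ℝ) : ℂ) • ∑ r, ∑ s,
      tensorId (unitaryChannel (pauli r ⊗ₖ pauli s)) k X := by
  ext x y
  have h := pauli_twirl (Matrix.of fun i j => X (i, x.2) (j, y.2))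
  have h' := congrFun (congrFun h x.1) y.1
  simp only [Matrix.smul_apply, Matrix.sum_apply, tensorId, Matrix.of_apply] at h' ⊢
  simp only [unitaryChannel, LinearMap.coe_mk, AddHom.coe_mk]
  rw [h']
  simp only [smul_eq_mul]
  push_cast
  ring

theorem traceNorm_tensorId_whiteNoise_le (k : ℕ)
    (X : Matrix ((Qubit × Qubit) × Fin k) ((Qubit × Qubit) × Fin k) ℂ) :
    traceNorm (tensorId whiteNoise k X) ≤ traceNorm X := by
  rw [tensorId_whiteNoise]
  refine (traceNorm_smul_le (by norm_num) _).trans ?_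
  have h : ∀ r s, traceNorm (tensorId (unitaryChannel (pauli r ⊗ₖ pauli s)) k X) ≤ traceNorm X :=
    fun r s => traceNorm_tensorId_unitaryChannel_le (Matrix.kronecker_mem_unitary
      (pauli_mem_unitaryGroup r) (pauli_mem_unitaryGroup s)) k X
  have h2 := (traceNorm_sum_le Finset.univ fun r =>
    ∑ s, tensorId (unitaryChannel (pauli r ⊗ₖ pauli s)) k X).trans
      (Finset.sum_le_sum fun r _ => (traceNorm_sum_le _ _).trans
        (Finset.sum_le_sum fun s _ => h r s))
  simp only [Finset.sum_const, Finset.card_univ, Fintype.card_fin, nsmul_eq_mul] at h2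
  push_cast at h2
  linarith

/-- A channel that applies `U` except for a fraction `t` of white noise has error at most `2 t`. -/
theorem diamondNorm_noisy_sub_le {U : Matrix (Qubit × Qubit) (Qubit × Qubit) ℂ}
    (hU : U ∈ Matrix.unitaryGroup (Qubit × Qubit) ℂ) {t : ℝ} (ht : 0 ≤ t) :
    diamondNorm ((t : ℂ) • (whiteNoise - unitaryChannel U)) ≤ ENNReal.ofReal (2 * t) := by
  refine iSup_le fun k => iSup_le fun X => iSup_le fun hX => ENNReal.ofReal_le_ofReal ?_
  have h : tensorId ((t : ℂ) • (whiteNoise - unitaryChannel U)) k X =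
      (t : ℂ) • (tensorId whiteNoise k X + -tensorId (unitaryChannel U) k X) := by
    ext x y
    simp [tensorId, sub_eq_add_neg, mul_add]
  rw [h]
  refine (traceNorm_smul_le ht _).trans ?_
  have h1 := (traceNorm_add_le (tensorId whiteNoise k X) (-tensorId (unitaryChannel U) k X))
  have h2 := traceNorm_neg_le (tensorId (unitaryChannel U) k X)
  have h3 := traceNorm_tensorId_unitaryChannel_le hU k X
  have h4 := traceNorm_tensorId_whiteNoise_le k X
  nlinarith

end Diamond

/-! ### Local measurements composed of single-ebit rounds. -/

noncomputable section

/-- A local measurement of one party on its qubit and its halves of `n` ebits that leaves one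
qubit. The Kraus operator of the outcome `a` is given by its blocks `ops a s`, where `s` is the
basis label of the halves. -/
structure LocalMeasurement (n : ℕ) where
  Out : Type
  [fintypeOut : Fintype Out]
  ops : Out → Halves n → Matrix Qubit Qubit ℂ
  complete : ∀ s t, ∑ a, (ops a s)ᴴ * ops a t = if s = t then 1 else 0

attribute [instance] LocalMeasurement.fintypeOut

/-- The operator on the two qubits that results from the local operators with blocks `A s` and
`B s` applied to the input and `n` ebits. -/
def jointKraus {n : ℕ} (A B : Halves n → Matrix Qubit Qubit ℂ) :
    Matrix (Qubit × Qubit) (Qubit × Qubit) ℂ :=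
  (1 / (Real.sqrt 2 : ℂ)) ^ n • ∑ s, A s ⊗ₖ B s

/-- One round of a local measurement, which consumes one half of an ebit. -/
structure Round where
  ops : Bool → Qubit → Matrix Qubit Qubit ℂ
  complete : ∀ h k, ∑ m, (ops m h)ᴴ * ops m k = if h = k then 1 else 0

/-- The operator on the two qubits that results from one round. -/
def roundKraus (M N : Qubit → Matrix Qubit Qubit ℂ) : Matrix (Qubit × Qubit) (Qubit × Qubit) ℂ :=
  (1 / (Real.sqrt 2 : ℂ)) • ∑ h, M h ⊗ₖ N h

theorem one_div_sqrt_two_mul_self : (1 / (Real.sqrt 2 : ℂ)) * (1 / (Real.sqrt 2 : ℂ)) = 1 / 2 := by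
  rw [div_mul_div_comm, one_mul, ← Complex.ofReal_mul, Real.mul_self_sqrt zero_le_two]
  norm_num

theorem star_one_div_sqrt_two : star (1 / (Real.sqrt 2 : ℂ)) = 1 / (Real.sqrt 2 : ℂ) := by
  rw [← Complex.ofReal_one, ← Complex.ofReal_div]
  exact Complex.conj_ofReal _

theorem norm_one_div_sqrt_two_sq : ‖(1 / (Real.sqrt 2 : ℂ))‖ ^ 2 = 1 / 2 := by
  rw [norm_div, norm_one, Complex.norm_real, Real.norm_of_nonneg (Real.sqrt_nonneg _), div_pow,
    Real.sq_sqrt zero_le_two, one_pow]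

theorem kronecker_sum_left {κ : Type*} (s : Finset κ) (A : κ → Matrix Qubit Qubit ℂ)
    (B : Matrix Qubit Qubit ℂ) : (∑ k ∈ s, A k) ⊗ₖ B = ∑ k ∈ s, A k ⊗ₖ B :=
  map_sum ((Matrix.kroneckerBilinear (R := ℂ) (α := ℂ)).flip B) A s

theorem kronecker_sum_right {κ : Type*} (s : Finset κ) (A : Matrix Qubit Qubit ℂ)
    (B : κ → Matrix Qubit Qubit ℂ) : A ⊗ₖ (∑ k ∈ s, B k) = ∑ k ∈ s, A ⊗ₖ B k :=
  map_sum (Matrix.kroneckerBilinear (R := ℂ) (α := ℂ) A) B s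

/-- All pairs of outcomes together have probability one. -/
theorem sum_jointKraus_conjTranspose_mul {n : ℕ} (A B : LocalMeasurement n) :
    ∑ a, ∑ b, (jointKraus (A.ops a) (B.ops b))ᴴ * jointKraus (A.ops a) (B.ops b) = 1 := by
  have h : ∀ a b, (jointKraus (A.ops a) (B.ops b))ᴴ * jointKraus (A.ops a) (B.ops b) =
      ((1 / 2 : ℂ) ^ n) • ∑ s, ∑ t, ((A.ops a s)ᴴ * A.ops a t) ⊗ₖ ((B.ops b s)ᴴ * B.ops b t) := by
    intro a b
    rw [jointKraus, Matrix.conjTranspose_smul, Matrix.smul_mul, Matrix.mul_smul, smul_smul,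
      star_pow, star_one_div_sqrt_two, ← mul_pow, one_div_sqrt_two_mul_self,
      Matrix.conjTranspose_sum, Finset.sum_mul_sum]
    simp only [Matrix.conjTranspose_kronecker, ← Matrix.mul_kronecker_mul]
  have h2 : ∀ s t, ∑ a, ∑ b, ((A.ops a s)ᴴ * A.ops a t) ⊗ₖ ((B.ops b s)ᴴ * B.ops b t) =
      if s = t then 1 else 0 := by
    intro s t
    simp only [← kronecker_sum_right, ← kronecker_sum_left, A.complete, B.complete]
    split_ifs <;> simp
  simp only [h, ← Finset.smul_sum]
  have h3 : ∑ a, ∑ b, ∑ s, ∑ t,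
      ((A.ops a s)ᴴ * A.ops a t) ⊗ₖ ((B.ops b s)ᴴ * B.ops b t) =
      ∑ s, ∑ t, ∑ a, ∑ b, ((A.ops a s)ᴴ * A.ops a t) ⊗ₖ ((B.ops b s)ᴴ * B.ops b t) := by
    simp_rw [Finset.sum_comm (s := (Finset.univ : Finset B.Out))]
    rw [Finset.sum_comm]
    refine Finset.sum_congr rfl fun s _ => ?_
    rw [Finset.sum_comm]
  rw [h3]
  simp only [h2, Finset.sum_ite_eq, Finset.mem_univ, if_true, Finset.sum_const, Finset.card_univ,
    Fintype.card_pi, Fintype.card_fin, Finset.prod_const]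
  -- The 2^n diagonal terms `s = t` cancel the weight 2^{-n} of the ebits.
  rw [← Nat.cast_smul_eq_nsmul ℂ, smul_smul]
  push_cast
  rw [← mul_pow]
  norm_num

/-- Tensor products of two one-qubit unitaries. -/
def IsLocalUnitary (L : Matrix (Qubit × Qubit) (Qubit × Qubit) ℂ) : Prop :=
  ∃ w ∈ Matrix.unitaryGroup Qubit ℂ, ∃ v ∈ Matrix.unitaryGroup Qubit ℂ, L = w ⊗ₖ v

theorem IsLocalUnitary.one : IsLocalUnitary 1 :=
  ⟨1, one_mem _, 1, one_mem _, Matrix.one_kronecker_one.symm⟩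

theorem IsLocalUnitary.mul {L M : Matrix (Qubit × Qubit) (Qubit × Qubit) ℂ}
    (hL : IsLocalUnitary L) (hM : IsLocalUnitary M) : IsLocalUnitary (L * M) := by
  obtain ⟨w, hw, v, hv, rfl⟩ := hL
  obtain ⟨w', hw', v', hv', rfl⟩ := hM
  exact ⟨w * w', mul_mem hw hw', v * v', mul_mem hv hv', (Matrix.mul_kronecker_mul ..).symm⟩

/-- The pair of local measurements performs `T` with probability `q`, up to local unitaries that
depend on both outcomes: on a success the operator is `c a b • (L * T)` with `c a b ≠ 0`. -/
def Achieves {n : ℕ} (A B : LocalMeasurement n)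
    (T : Matrix (Qubit × Qubit) (Qubit × Qubit) ℂ) (q : ℝ) : Prop :=
  ∃ c : A.Out → B.Out → ℂ,
    (∀ a b, c a b = 0 ∨
      ∃ L, IsLocalUnitary L ∧ jointKraus (A.ops a) (B.ops b) = c a b • (L * T)) ∧
    ∑ a, ∑ b, ‖c a b‖ ^ 2 = q

theorem achieves_zero {n : ℕ} (A B : LocalMeasurement n)
    (T : Matrix (Qubit × Qubit) (Qubit × Qubit) ℂ) : Achieves A B T 0 :=
  ⟨fun _ _ => 0, fun _ _ => Or.inl rfl, by simp⟩

namespace LocalMeasurement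

/-- A round followed by a measurement that depends on the outcome of the round. -/
def cons {n : ℕ} (R : Round) (A : Bool → LocalMeasurement n) : LocalMeasurement (n + 1) where
  Out := Σ m, (A m).Out
  ops o s := (A o.1).ops o.2 (Fin.tail s) * R.ops o.1 (s 0)
  complete s t := by
    rw [Fintype.sum_sigma]
    have h : ∀ m, ∑ a, ((A m).ops a (Fin.tail s) * R.ops m (s 0))ᴴ *
        ((A m).ops a (Fin.tail t) * R.ops m (t 0)) =
        if Fin.tail s = Fin.tail t then (R.ops m (s 0))ᴴ * R.ops m (t 0) else 0 := by
      intro m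
      have h1 : ∀ a, ((A m).ops a (Fin.tail s) * R.ops m (s 0))ᴴ *
        ((A m).ops a (Fin.tail t) * R.ops m (t 0)) = (R.ops m (s 0))ᴴ *
          (((A m).ops a (Fin.tail s))ᴴ * (A m).ops a (Fin.tail t)) * R.ops m (t 0) := by
        intro a
        simp only [Matrix.conjTranspose_mul, Matrix.mul_assoc]
      simp only [h1, ← Matrix.sum_mul, ← Matrix.mul_sum, (A m).complete]
      split_ifs <;> simp
    have hst : s = t ↔ Fin.tail s = Fin.tail t ∧ s 0 = t 0 := by
      constructor
      · rintro rfl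
        exact ⟨rfl, rfl⟩
      · rintro ⟨h1, h2⟩
        rw [← Fin.cons_self_tail s, ← Fin.cons_self_tail t, h1, h2]
    have hR := R.complete (s 0) (t 0)
    simp only [h]
    by_cases h1 : Fin.tail s = Fin.tail t
    · simp only [h1, if_true, hR, hst, true_and]
    · simp [h1, hst]

/-- A measurement preceded by a unitary on the qubit. -/
def precomp {n : ℕ} (A : LocalMeasurement n) (w : Matrix Qubit Qubit ℂ)
    (hw : w ∈ Matrix.unitaryGroup Qubit ℂ) : LocalMeasurement n where
  Out := A.Out
  ops a s := A.ops a s * w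
  complete s t := by
    have h1 : ∀ a, (A.ops a s * w)ᴴ * (A.ops a t * w) =
        wᴴ * ((A.ops a s)ᴴ * A.ops a t) * w := by
      intro a
      simp only [Matrix.conjTranspose_mul, Matrix.mul_assoc]
    simp only [h1, ← Matrix.sum_mul, ← Matrix.mul_sum, A.complete]
    split_ifs
    · rw [Matrix.mul_one]
      exact (Matrix.mem_unitaryGroup_iff').1 hw
    · simp

/-- The measurement that does nothing and consumes nothing. -/
def trivial : LocalMeasurement 0 where
  Out := Unit
  ops _ _ := 1
  complete s t := by simp [Subsingleton.elim s t]

end LocalMeasurement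

/-- Distinct ebits are in a product state, so the sum over basis labels factorizes and consecutive
rounds multiply. -/
theorem jointKraus_cons {n : ℕ} (A B : Halves n → Matrix Qubit Qubit ℂ)
    (M N : Qubit → Matrix Qubit Qubit ℂ) :
    jointKraus (n := n + 1) (fun s => A (Fin.tail s) * M (s 0)) (fun s => B (Fin.tail s) * N (s 0))
      = jointKraus A B * roundKraus M N := by
  rw [jointKraus, jointKraus, roundKraus, Matrix.smul_mul, Matrix.mul_smul, smul_smul, ← pow_succ,
    Finset.sum_mul_sum, ← (Fin.consEquiv fun _ => Qubit).sum_comp, Fintype.sum_prod_type,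
    Finset.sum_comm]
  simp [Fin.consEquiv, Matrix.mul_kronecker_mul]

/-- Each party adapts only to its own outcome, so no communication is used; yet the remaining target
`T' m b` may depend on both outcomes. It has to make up for what the round did, up to a local
unitary on the left. -/
theorem Achieves.cons {n : ℕ} {R S : Round} {A B : Bool → LocalMeasurement n}
    {T' : Bool → Bool → Matrix (Qubit × Qubit) (Qubit × Qubit) ℂ} {q : Bool → Bool → ℝ}
    {T : Matrix (Qubit × Qubit) (Qubit × Qubit) ℂ} (d : Bool → Bool → ℂ)
    (h : ∀ m b, Achieves (A m) (B b) (T' m b) (q m b))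
    (hT : ∀ m b, ∃ L, IsLocalUnitary L ∧
      T' m b * roundKraus (R.ops m) (S.ops b) = d m b • (L * T)) :
    Achieves (LocalMeasurement.cons R A) (LocalMeasurement.cons S B) T
      (∑ m, ∑ b, ‖d m b‖ ^ 2 * q m b) := by
  choose c hc hq using h
  refine ⟨fun a b => d a.1 b.1 * c a.1 b.1 a.2 b.2, ?_, ?_⟩
  · rintro ⟨m, a⟩ ⟨b, b'⟩
    rcases hc m b a b' with h0 | ⟨L, hL, hK⟩
    · left
      simp [h0]
    · right
      obtain ⟨L', hL', hT'⟩ := hT m b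
      refine ⟨L * L', hL.mul hL', ?_⟩
      refine (jointKraus_cons ((A m).ops a) ((B b).ops b') (R.ops m) (S.ops b)).trans ?_
      rw [hK, Matrix.smul_mul, Matrix.mul_assoc, hT', Matrix.mul_smul, smul_smul, Matrix.mul_assoc,
        mul_comm]
  · have h1 : ∀ m b, ∑ a, ∑ b', ‖d m b * c m b a b'‖ ^ 2 = ‖d m b‖ ^ 2 * q m b := by
      intro m b
      simp only [← hq, norm_mul, mul_pow, Finset.mul_sum]
    simp only [← h1]
    refine (Fintype.sum_sigma (M := ℝ) (α := fun m => (A m).Out) _).trans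
      (Finset.sum_congr rfl fun m _ => ?_)
    refine Eq.trans ?_ Finset.sum_comm
    exact Finset.sum_congr rfl fun a _ => Fintype.sum_sigma (M := ℝ) (α := fun b => (B b).Out) _

theorem Achieves.precomp {n : ℕ} {A B : LocalMeasurement n}
    {T : Matrix (Qubit × Qubit) (Qubit × Qubit) ℂ} {q : ℝ} (h : Achieves A B T q)
    {w v : Matrix Qubit Qubit ℂ} (hw : w ∈ Matrix.unitaryGroup Qubit ℂ)
    (hv : v ∈ Matrix.unitaryGroup Qubit ℂ) :
    Achieves (A.precomp w hw) (B.precomp v hv) (T * (w ⊗ₖ v)) q := by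
  obtain ⟨c, hc, hq⟩ := h
  refine ⟨c, fun a b => (hc a b).imp_right ?_, hq⟩
  rintro ⟨L, hL, hK⟩
  refine ⟨L, hL, ?_⟩
  rw [← Matrix.mul_assoc, ← Matrix.smul_mul, ← hK]
  simp only [jointKraus, LocalMeasurement.precomp, Matrix.mul_kronecker_mul, Matrix.smul_mul,
    Matrix.sum_mul]

/-- Local unitaries on the left are free, because they are corrected after the broadcast. -/
theorem Achieves.local_mul {n : ℕ} {A B : LocalMeasurement n}
    {T L : Matrix (Qubit × Qubit) (Qubit × Qubit) ℂ} {q : ℝ} {z : ℂ} (h : Achieves A B T q)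
    (hz : ‖z‖ = 1) (hL : IsLocalUnitary L) : Achieves A B (z • (L * T)) q := by
  obtain ⟨w, hw, v, hv, rfl⟩ := hL
  obtain ⟨c, hc, hq⟩ := h
  have hz0 : z ≠ 0 := by
    rintro rfl
    simp at hz
  refine ⟨fun a b => c a b * z⁻¹, fun a b => (hc a b).imp (fun h => by simp [h]) ?_, ?_⟩
  · rintro ⟨L', hL', hK⟩
    refine ⟨L' * (star w ⊗ₖ star v), hL'.mul ⟨_, Unitary.star_mem hw, _, Unitary.star_mem hv, rfl⟩,
      ?_⟩
    rw [hK, Matrix.mul_smul, smul_smul, inv_mul_cancel_right₀ hz0, Matrix.mul_assoc,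
      ← Matrix.mul_assoc (star w ⊗ₖ star v), ← Matrix.mul_kronecker_mul,
      (Matrix.mem_unitaryGroup_iff').1 hw, (Matrix.mem_unitaryGroup_iff').1 hv,
      Matrix.one_kronecker_one, Matrix.one_mul]
  · simpa [hz] using hq

theorem achieves_trivial : Achieves LocalMeasurement.trivial LocalMeasurement.trivial 1 1 := by
  refine ⟨fun _ _ => 1, fun a b => Or.inr ⟨1, IsLocalUnitary.one, ?_⟩, ?_⟩
  · simp [jointKraus, LocalMeasurement.trivial]
  · change ∑ _ : Unit, ∑ _ : Unit, _ = _
    simp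

/-- The round that measures the half of the ebit in the computational basis. -/
def discardRound : Round where
  ops m h := if h = bif m then 1 else 0 then 1 else 0
  complete h k := by fin_cases h <;> fin_cases k <;> simp

theorem exists_achieves_one (n : ℕ) : ∃ A B : LocalMeasurement n, Achieves A B 1 1 := by
  induction n with
  | zero => exact ⟨_, _, achieves_trivial⟩
  | succ n ih =>
    obtain ⟨A, B, h⟩ := ih
    refine ⟨.cons discardRound fun _ => A, .cons discardRound fun _ => B, ?_⟩
    have := Achieves.cons (R := discardRound) (S := discardRound) (A := fun _ => A)
      (B := fun _ => B) (T := 1) (fun m b => if m = b then 1 / (Real.sqrt 2 : ℂ) else 0)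
      (fun _ _ => h) fun m b => ⟨1, IsLocalUnitary.one, by
        cases m <;> cases b <;> simp [roundKraus, discardRound]⟩
    convert this using 1
    simp only [mul_one, Fintype.sum_bool, if_true, norm_one_div_sqrt_two_sq]
    norm_num

end

/-! ### Repeat-until-success for exp(iβ P⊗P) without communication. -/

noncomputable section

/-- The sign `-1` for `true` and `1` for `false`. -/
def sg (b : Bool) : ℝ := bif b then -1 else 1

/-- The sign of a basis label of a qubit. -/
def qsg (h : Qubit) : ℂ := ![1, -1] h

/-- The two-qubit gate `exp (i β P ⊗ P)` for an involution `P`. -/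
def pauliGate (P : Matrix Qubit Qubit ℂ) (β : ℝ) : Matrix (Qubit × Qubit) (Qubit × Qubit) ℂ :=
  (Real.cos β : ℂ) • 1 + (Complex.I * Real.sin β) • (P ⊗ₖ P)

theorem pauliGate_add {P : Matrix Qubit Qubit ℂ} (hP : P * P = 1) (β γ : ℝ) :
    pauliGate P (β + γ) = pauliGate P β * pauliGate P γ := by
  have h : (P ⊗ₖ P) * (P ⊗ₖ P) = 1 := by
    rw [← Matrix.mul_kronecker_mul, hP, Matrix.one_kronecker_one]
  simp only [pauliGate, Matrix.add_mul, Matrix.mul_add, Matrix.smul_mul, Matrix.mul_smul, h,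
    Matrix.mul_one, Matrix.one_mul, smul_add, smul_smul, Real.cos_add, Real.sin_add]
  match_scalars
  · linear_combination (-Complex.sin β * Complex.sin γ : ℂ) * Complex.I_mul_I
  · ring

/-- A byproduct on either side changes the sign of Q⊗Q, hence of the angle. -/
theorem pauliGate_mul_of_anticommute {P Q : Matrix Qubit Qubit ℂ} (h : Q * P = -(P * Q)) (β : ℝ) :
    pauliGate Q (-β) * (P ⊗ₖ 1) = (P ⊗ₖ 1) * pauliGate Q β ∧
      pauliGate Q (-β) * (1 ⊗ₖ P) = (1 ⊗ₖ P) * pauliGate Q β := by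
  constructor <;>
  · simp only [pauliGate, Matrix.add_mul, Matrix.mul_add, Matrix.smul_mul, Matrix.mul_smul,
      Matrix.mul_one, Matrix.one_mul, ← Matrix.mul_kronecker_mul, h, Real.cos_neg, Real.sin_neg]
    congr 1
    ext i j
    simp

section Rounds

variable (P : Matrix Qubit Qubit ℂ)

/-- Alice's operators for copying the `P`-value of her qubit to Bob's half of the ebit: she measures
the parity of her qubit and her half. -/
def copyOps (m : Bool) (h : Qubit) : Matrix Qubit Qubit ℂ :=
  (1 / 2 : ℂ) • (1 + ((sg m : ℂ) * qsg h) • P)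

/-- Alice's operators for leaving the qubits alone: she measures her half in the basis `|±⟩`. -/
def idleOps (x : Bool) (h : Qubit) : Matrix Qubit Qubit ℂ :=
  ((1 / (Real.sqrt 2 : ℂ)) * bif x then qsg h else 1) • 1

/-- Bob's operators: he applies `exp (i θ Z ⊗ P)` to his half and his qubit and measures his half
in the basis `|±⟩`. -/
def rotateOps (θ : ℝ) (b : Bool) (h : Qubit) : Matrix Qubit Qubit ℂ :=
  ((1 / (Real.sqrt 2 : ℂ)) * bif b then qsg h else 1) •
    ((Real.cos θ : ℂ) • 1 + (Complex.I * Real.sin θ * qsg h) • P)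

variable {P}

/-- The round in which Alice copies her qubit. -/
def copyRound (hP : P * P = 1) (hP' : Pᴴ = P) : Round where
  ops := copyOps P
  complete h k := by
    simp only [copyOps, Fintype.sum_bool, Matrix.conjTranspose_smul, Matrix.conjTranspose_add,
      Matrix.conjTranspose_one, hP', Matrix.smul_mul, Matrix.mul_smul, Matrix.add_mul,
      Matrix.mul_add, Matrix.one_mul, Matrix.mul_one, hP]
    fin_cases h <;> fin_cases k <;> simp [sg, qsg] <;> module

/-- The round in which Alice does nothing. -/
def idleRound : Round where
  ops := idleOps
  complete h k := by
    have hs := one_div_sqrt_two_mul_self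
    have hs' := star_one_div_sqrt_two
    simp only [idleOps, Fintype.sum_bool, Matrix.conjTranspose_smul, Matrix.conjTranspose_one,
      Matrix.smul_mul, Matrix.mul_smul, Matrix.one_mul, star_mul', hs', smul_smul, ← add_smul]
    have h2 : ∀ x y : ℂ, 1 / (Real.sqrt 2 : ℂ) * x * (1 / (Real.sqrt 2 : ℂ) * y) =
        1 / 2 * (x * y) := by
      intro x y
      rw [← hs]
      ring
    simp only [h2]
    fin_cases h <;> fin_cases k <;> simp [qsg] <;> norm_num

/-- Bob's round. -/
def rotateRound (hP : P * P = 1) (hP' : Pᴴ = P) (θ : ℝ) : Round where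
  ops := rotateOps P θ
  complete h k := by
    have hs := one_div_sqrt_two_mul_self
    have hs' := star_one_div_sqrt_two
    have hc : star (Real.cos θ : ℂ) = Real.cos θ := Complex.conj_ofReal _
    have hn : star (Real.sin θ : ℂ) = Real.sin θ := Complex.conj_ofReal _
    have hi : star Complex.I = -Complex.I := Complex.conj_I
    have hcs : (Real.cos θ : ℂ) * Real.cos θ + Real.sin θ * Real.sin θ = 1 := by
      rw [← Complex.ofReal_mul, ← Complex.ofReal_mul, ← Complex.ofReal_add, ← sq, ← sq,
        Real.cos_sq_add_sin_sq, Complex.ofReal_one]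
    have hII := Complex.I_mul_I
    simp only [rotateOps]
    generalize (Real.cos θ : ℂ) = c at *
    generalize (Real.sin θ : ℂ) = n at *
    generalize 1 / (Real.sqrt 2 : ℂ) = r at *
    generalize Complex.I = i at *
    simp only [Fintype.sum_bool, Matrix.conjTranspose_smul, Matrix.conjTranspose_add,
      Matrix.conjTranspose_one, hP', Matrix.smul_mul, Matrix.mul_smul, Matrix.add_mul,
      Matrix.mul_add, Matrix.one_mul, Matrix.mul_one, hP, star_mul']
    fin_cases h <;> fin_cases k <;> simp [qsg, -Complex.star_def, hs', hc, hn, hi] <;>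
      match_scalars <;>
      first
        | ring1
        | linear_combination 2 * (c * c - i * i * n * n) * hs + hcs - n * n * hII

/-- Alice's projection forces `qsg h` to equal `sg m` times the value of P on her qubit, so Bob's
Z⊗P acts as `sg m` P⊗P. His outcome `b` contributes the factor (`sg m` P⊗1)^b. All four outcome
pairs have amplitude of modulus 1/2. -/
theorem roundKraus_copy_rotate (hP : P * P = 1) (m b : Bool) (θ : ℝ) :
    roundKraus (copyOps P m) (rotateOps P θ b) =
      ((1 / 2 : ℂ) * sg (m && b)) • ((bif b then P ⊗ₖ 1 else 1) * pauliGate P (sg m * θ)) := by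
  have hs := one_div_sqrt_two_mul_self
  have hPP : (P ⊗ₖ (1 : Matrix Qubit Qubit ℂ)) * (P ⊗ₖ P) = 1 ⊗ₖ P := by
    rw [← Matrix.mul_kronecker_mul, hP, Matrix.one_mul]
  simp only [roundKraus, copyOps, rotateOps, pauliGate, Fin.sum_univ_two, Matrix.smul_kronecker,
    Matrix.kronecker_smul, Matrix.add_kronecker, Matrix.kronecker_add, Matrix.mul_add,
    Matrix.mul_smul, Matrix.one_kronecker_one]
  generalize 1 / (Real.sqrt 2 : ℂ) = r at *
  cases m <;> cases b <;> simp [sg, qsg, hPP, Real.cos_neg, Real.sin_neg] <;> match_scalars <;>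
    first
      | ring1
      | linear_combination (Complex.cos θ) * hs
      | linear_combination (Complex.I * Complex.sin θ) * hs
      | linear_combination -(Complex.cos θ) * hs
      | linear_combination -(Complex.I * Complex.sin θ) * hs

/-- Summing over the label `h` keeps the even part of Bob's rotation if the outcomes agree and the
odd part otherwise; either is harmless, whatever the angle. -/
theorem roundKraus_idle_rotate (x b : Bool) (θ : ℝ) :
    roundKraus (idleOps x) (rotateOps P θ b) =
      if x = b then (1 / (Real.sqrt 2 : ℂ) * Real.cos θ) • 1 else
        (1 / (Real.sqrt 2 : ℂ) * (Complex.I * Real.sin θ)) • (1 ⊗ₖ P) := by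
  have hs := one_div_sqrt_two_mul_self
  simp only [roundKraus, idleOps, rotateOps, Fin.sum_univ_two, Matrix.smul_kronecker,
    Matrix.kronecker_smul, Matrix.kronecker_add, Matrix.one_kronecker_one]
  generalize 1 / (Real.sqrt 2 : ℂ) = r at *
  cases x <;> cases b <;> simp [qsg] <;> match_scalars <;>
    first
      | ring1
      | linear_combination 2 * r * (Complex.cos θ) * hs
      | linear_combination 2 * r * (Complex.I * Complex.sin θ) * hs

end Rounds

theorem Achieves.prob_eq {n : ℕ} {A B : LocalMeasurement n}
    {T : Matrix (Qubit × Qubit) (Qubit × Qubit) ℂ} {q r : ℝ} (h : Achieves A B T q) (hq : q = r) :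
    Achieves A B T r :=
  hq ▸ h

theorem sg_sq_norm (b : Bool) : ‖((sg b : ℝ) : ℂ)‖ ^ 2 = 1 := by
  cases b <;> simp [sg]

theorem mem_unitaryGroup_of_involution {P : Matrix Qubit Qubit ℂ} (hP : P * P = 1)
    (hP' : Pᴴ = P) : P ∈ Matrix.unitaryGroup Qubit ℂ := by
  rw [Matrix.mem_unitaryGroup_iff, Matrix.star_eq_conjTranspose, hP', hP]

/-- Prepending `N` attempts at a gate `exp (i β P ⊗ P)`. The target `F s` of the remaining protocol
depends on a sign that is shared between Alice and Bob, and is flipped by the byproduct operators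
`P ⊗ 1` and `1 ⊗ P`. If an attempt goes wrong, then twice the angle is left to be done; when an
attempt has succeeded, Alice, who learns this, leaves the qubits alone in all later ones. -/
theorem exists_attempts {P : Matrix Qubit Qubit ℂ} (hP : P * P = 1) (hP' : Pᴴ = P)
    {F : Bool → Matrix (Qubit × Qubit) (Qubit × Qubit) ℂ}
    (hF₁ : ∀ s, F (!s) * (P ⊗ₖ 1) = (P ⊗ₖ 1) * F s)
    (hF₂ : ∀ s, F (!s) * (1 ⊗ₖ P) = (1 ⊗ₖ P) * F s)
    {n : ℕ} {A B : Bool → LocalMeasurement n} {q : ℝ}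
    (h : ∀ u v, Achieves (A u) (B v) (F (u ^^ v)) q) (N : ℕ) :
    ∃ (need : Bool → Bool → LocalMeasurement (n + N)) (done : Bool → LocalMeasurement (n + N))
      (bob : ℝ → Bool → Bool → LocalMeasurement (n + N)),
      (∀ β u u' v v', Achieves (need u u') (bob β v v')
        (F (u' ^^ v') * pauliGate P (sg (u ^^ v) * β)) ((1 - (1 / 2) ^ N) * q)) ∧
      ∀ β u' v v', Achieves (done u') (bob β v v') (F (u' ^^ v')) q := by
  have hL₁ : IsLocalUnitary (P ⊗ₖ 1) :=
    ⟨P, mem_unitaryGroup_of_involution hP hP', 1, one_mem _, rfl⟩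
  have hL₂ : IsLocalUnitary (1 ⊗ₖ P) :=
    ⟨1, one_mem _, P, mem_unitaryGroup_of_involution hP hP', rfl⟩
  induction N with
  | zero =>
    -- With no attempt left, a gate that is still needed counts as a failure, of success probability
    -- zero.
    refine ⟨fun _ => A, A, fun _ _ => B, fun β u u' v v' => ?_, fun β u' v v' => h u' v'⟩
    simpa using achieves_zero _ _ _
  | succ N ih =>
    obtain ⟨need, done, bob, hneed, hdone⟩ := ih
    -- The bits `u`, `v` share the sign of the present gate and `u'`, `v'` the sign of `F`. The
    -- attempt has the right sign exactly if `m = u`, which Alice can check. Bob doubles his angle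
    -- in any case, and the byproducts enter `u'` and `v'` only.
    refine ⟨fun u u' => .cons (copyRound hP hP') fun m => if m = u then done u' else need u u',
      fun u' => .cons idleRound fun x => done (u' ^^ x),
      fun β v v' => .cons (rotateRound hP hP' (sg v * β)) fun b => bob (2 * β) v (v' ^^ b),
      fun β u u' v v' => ?_, fun β u' v v' => ?_⟩
    · have hF : ∀ b, F (u' ^^ (v' ^^ b)) * (bif b then P ⊗ₖ 1 else 1) =
          (bif b then P ⊗ₖ 1 else 1) * F (u' ^^ v') := by
        intro b
        cases b
        · simp
        · simpa using hF₁ (u' ^^ v')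
      have hL : ∀ b, IsLocalUnitary (bif b then P ⊗ₖ 1 else 1) := by
        intro b
        cases b
        exacts [.one, hL₁]
      have hG : ∀ b, pauliGate P (sg (u ^^ v) * (2 * β)) * (bif b then P ⊗ₖ 1 else 1) =
          (bif b then P ⊗ₖ 1 else 1) * pauliGate P (sg (u ^^ v) * (2 * β)) := by
        intro b
        cases b <;>
          simp [pauliGate, Matrix.add_mul, Matrix.mul_add, ← Matrix.mul_kronecker_mul]
      have key := Achieves.cons (R := copyRound hP hP') (S := rotateRound hP hP' (sg v * β))
        (A := fun m => if m = u then done u' else need u u')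
        (B := fun b => bob (2 * β) v (v' ^^ b))
        (T := F (u' ^^ v') * pauliGate P (sg (u ^^ v) * β))
        (T' := fun m b => if m = u then F (u' ^^ (v' ^^ b)) else
          F (u' ^^ (v' ^^ b)) * pauliGate P (sg (u ^^ v) * (2 * β)))
        (q := fun m _ => if m = u then q else (1 - (1 / 2) ^ N) * q)
        (fun m b => (1 / 2 : ℂ) * sg (m && b)) (fun m b => by
          by_cases hm : m = u
          · simpa [hm] using hdone (2 * β) u' v (v' ^^ b)
          · simpa [hm] using hneed (2 * β) u u' v (v' ^^ b)) (fun m b => by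
          refine ⟨bif b then P ⊗ₖ 1 else 1, hL b, ?_⟩
          change _ * roundKraus (copyOps P m) (rotateOps P _ b) = _
          rw [roundKraus_copy_rotate hP, Matrix.mul_smul]
          congr 1
          by_cases hm : m = u
          · simp only [if_pos hm]
            rw [← Matrix.mul_assoc, hF, Matrix.mul_assoc]
            congr 3
            subst hm
            cases m <;> cases v <;> simp [sg]
          · simp only [if_neg hm]
            -- The byproduct commutes with the P-gate and moves through `F`; the angles add up as 2θ
            -- + (-θ) = θ.
            rw [← Matrix.mul_assoc, Matrix.mul_assoc (F _), hG, ← Matrix.mul_assoc, hF,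
              Matrix.mul_assoc, Matrix.mul_assoc, ← pauliGate_add hP]
            congr 3
            cases m <;> cases u <;> cases v <;> simp [sg] at hm ⊢ <;> ring)
      refine key.prob_eq ?_
      -- Two of the four pairs, each of weight 1/4, succeed: q/2 + (1 - 2^{-N})q/2 = (1 -
      -- 2^{-(N+1)})q.
      simp only [norm_mul, mul_pow, sg_sq_norm, Fintype.sum_bool]
      cases u <;> simp <;> ring
    · have key := Achieves.cons (R := idleRound) (S := rotateRound hP hP' (sg v * β))
        (A := fun x => done (u' ^^ x)) (B := fun b => bob (2 * β) v (v' ^^ b))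
        (T := F (u' ^^ v')) (T' := fun x b => F ((u' ^^ x) ^^ (v' ^^ b))) (q := fun _ _ => q)
        (fun x b => if x = b then 1 / (Real.sqrt 2 : ℂ) * Real.cos (sg v * β) else
          1 / (Real.sqrt 2 : ℂ) * (Complex.I * Real.sin (sg v * β)))
        (fun x b => hdone (2 * β) _ v _) (fun x b => by
          change ∃ L, _ ∧ _ * roundKraus (idleOps x) (rotateOps P _ b) = _
          rw [roundKraus_idle_rotate]
          by_cases hx : x = b
          · refine ⟨1, .one, ?_⟩
            subst hx
            rw [if_pos rfl, if_pos rfl, Matrix.mul_smul, Matrix.mul_one, Matrix.one_mul]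
            cases x <;> simp
          · refine ⟨1 ⊗ₖ P, hL₂, ?_⟩
            rw [if_neg hx, if_neg hx, Matrix.mul_smul, ← hF₂]
            cases x <;> cases b <;> simp at hx ⊢)
      refine key.prob_eq ?_
      simp only [Fintype.sum_bool, if_true, Bool.true_eq_false, Bool.false_eq_true, if_false,
        norm_mul, mul_pow, norm_one_div_sqrt_two_sq, Complex.norm_I, Complex.norm_real,
        Real.norm_eq_abs, sq_abs]
      linear_combination q * Real.sin_sq_add_cos_sq (sg v * β)

/-- The rounds of `exists_attempts`, as seen by the rounds before them. -/
theorem exists_achieves_mul_pauliGate {P : Matrix Qubit Qubit ℂ} (hP : P * P = 1) (hP' : Pᴴ = P)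
    {F : Bool → Matrix (Qubit × Qubit) (Qubit × Qubit) ℂ}
    (hF₁ : ∀ s, F (!s) * (P ⊗ₖ 1) = (P ⊗ₖ 1) * F s)
    (hF₂ : ∀ s, F (!s) * (1 ⊗ₖ P) = (1 ⊗ₖ P) * F s)
    {n : ℕ} {q : ℝ}
    (h : ∃ A B : Bool → LocalMeasurement n, ∀ u v, Achieves (A u) (B v) (F (u ^^ v)) q)
    (N : ℕ) (β : ℝ) :
    ∃ A B : Bool → LocalMeasurement (n + N), ∀ u v,
      Achieves (A u) (B v) (F (u ^^ v) * pauliGate P (sg (u ^^ v) * β))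
        ((1 - (1 / 2) ^ N) * q) := by
  obtain ⟨A, B, h⟩ := h
  obtain ⟨need, _, bob, hneed, _⟩ := exists_attempts hP hP' hF₁ hF₂ h N
  -- Byproducts of earlier gates flip this gate and `F` alike, so both pairs of sign bits start out
  -- equal.
  exact ⟨fun u => need u u, fun v => bob β v v, fun u v => hneed β u u v v⟩

/-- The Pauli matrix `X`. -/
def pauliX : Matrix Qubit Qubit ℂ := !![0, 1; 1, 0]

/-- The Pauli matrix `Y`. -/
def pauliY : Matrix Qubit Qubit ℂ := !![0, -Complex.I; Complex.I, 0]

/-- The Pauli matrix `Z`. -/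
def pauliZ : Matrix Qubit Qubit ℂ := !![1, 0; 0, -1]

theorem exists_achieves_canonical (α β γ : ℝ) (N : ℕ) :
    ∃ A B : LocalMeasurement (8 * N + 1),
      Achieves A B (pauliGate pauliY γ * pauliGate pauliX β * pauliGate pauliZ α)
        (successProb N) := by
  have hX : pauliX * pauliX = 1 := by
    ext i j
    fin_cases i <;> fin_cases j <;> simp [pauliX]
  have hY : pauliY * pauliY = 1 := by
    ext i j
    fin_cases i <;> fin_cases j <;> simp [pauliY]
  have hZ : pauliZ * pauliZ = 1 := by
    ext i j
    fin_cases i <;> fin_cases j <;> simp [pauliZ]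
  have hX' : pauliXᴴ = pauliX := by
    ext i j
    fin_cases i <;> fin_cases j <;> simp [pauliX]
  have hY' : pauliYᴴ = pauliY := by
    ext i j
    fin_cases i <;> fin_cases j <;> simp [pauliY]
  have hZ' : pauliZᴴ = pauliZ := by
    ext i j
    fin_cases i <;> fin_cases j <;> simp [pauliZ]
  have hYX : pauliY * pauliX = -(pauliX * pauliY) := by
    ext i j
    fin_cases i <;> fin_cases j <;> simp [pauliX, pauliY]
  have hYZ : pauliY * pauliZ = -(pauliZ * pauliY) := by
    ext i j
    fin_cases i <;> fin_cases j <;> simp [pauliZ, pauliY]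
  have hXZ : pauliX * pauliZ = -(pauliZ * pauliX) := by
    ext i j
    fin_cases i <;> fin_cases j <;> simp [pauliZ, pauliX]
  have hsg : ∀ s (θ : ℝ), sg (!s) * θ = -(sg s * θ) := by
    intro s θ
    cases s <;> simp [sg]
  -- The three gates use only 3N ebits; the other 5N + 1 are measured and discarded to match the
  -- stated count.
  obtain ⟨A₀, B₀, h₀⟩ := exists_achieves_one (5 * N + 1)
  have h₁ := exists_achieves_mul_pauliGate hY hY' (F := fun _ => 1) (by simp) (by simp)
    ⟨fun _ => A₀, fun _ => B₀, fun _ _ => h₀⟩ N γ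
  have h₂ := exists_achieves_mul_pauliGate hX hX'
    (F := fun s => 1 * pauliGate pauliY (sg s * γ))
    (fun s => by
      simpa [hsg] using (pauliGate_mul_of_anticommute hYX (sg s * γ)).1)
    (fun s => by
      simpa [hsg] using (pauliGate_mul_of_anticommute hYX (sg s * γ)).2) h₁ N β
  obtain ⟨A, B, h₃⟩ := exists_achieves_mul_pauliGate hZ hZ'
    (F := fun s => 1 * pauliGate pauliY (sg s * γ) * pauliGate pauliX (sg s * β))
    (fun s => by
      simp only [hsg, Matrix.one_mul]
      rw [Matrix.mul_assoc, (pauliGate_mul_of_anticommute hXZ (sg s * β)).1, ← Matrix.mul_assoc,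
        (pauliGate_mul_of_anticommute hYZ (sg s * γ)).1, Matrix.mul_assoc])
    (fun s => by
      simp only [hsg, Matrix.one_mul]
      rw [Matrix.mul_assoc, (pauliGate_mul_of_anticommute hXZ (sg s * β)).2, ← Matrix.mul_assoc,
        (pauliGate_mul_of_anticommute hYZ (sg s * γ)).2, Matrix.mul_assoc]) h₂ N α
  have hn : 5 * N + 1 + N + N + N = 8 * N + 1 := by ring
  rw [← hn]
  refine ⟨A false, B false, ?_⟩
  convert h₃ false false using 1
  · simp [sg]
  · rw [successProb]
    ring

end

/-! ### Factorization of a unitary as orthogonal · diagonal · orthogonal. -/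

noncomputable section

theorem map_ofReal_mul {ι : Type*} [Fintype ι] (A B : Matrix ι ι ℝ) :
    (A * B).map Complex.ofReal = A.map Complex.ofReal * B.map Complex.ofReal :=
  Matrix.map_mul (f := Complex.ofRealHom)

theorem exists_map_ofReal_eq {ι : Type*} {H : Matrix ι ι ℂ} (h : Hᴴ = Hᵀ) :
    ∃ R : Matrix ι ι ℝ, R.map Complex.ofReal = H := by
  refine ⟨H.map Complex.re, ?_⟩
  ext i j
  have h1 := congrFun (congrFun h j) i
  rw [Matrix.conjTranspose_apply, Matrix.transpose_apply] at h1
  simpa using Complex.conj_eq_iff_re.1 h1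

section SymmetricUnitary

variable {ι : Type*} [Fintype ι] [DecidableEq ι]

/-- The unit circle is infinite and `S` has finitely many eigenvalues. The shift makes a Cayley
transform available even if -1 is an eigenvalue. -/
theorem exists_norm_one_isUnit_one_add_smul (S : Matrix ι ι ℂ) :
    ∃ z : ℂ, ‖z‖ = 1 ∧ IsUnit (z • 1 + S).det := by
  have hinf : (Set.range fun c : Circle => -(c : ℂ)).Infinite := by
    have : Infinite Circle :=
      Circle.argEquiv.infinite_iff.2 (Set.Ioc_infinite (by linarith [Real.pi_pos])).to_subtype
    refine Set.infinite_range_of_injective fun a b hab => ?_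
    exact Circle.ext (neg_injective hab)
  obtain ⟨w, ⟨c, rfl⟩, hc⟩ := hinf.exists_notMem_finset S.charpoly.roots.toFinset
  refine ⟨c, c.norm_coe, ?_⟩
  rw [Multiset.mem_toFinset, Polynomial.mem_roots S.charpoly_monic.ne_zero, Polynomial.IsRoot,
    Matrix.eval_charpoly] at hc
  rw [isUnit_iff_ne_zero]
  intro h0
  apply hc
  have h1 : Matrix.scalar ι (-(c : ℂ)) - S = -((c : ℂ) • 1 + S) := by
    rw [Matrix.scalar_apply, ← Matrix.smul_one_eq_diagonal]
    module
  rw [h1, Matrix.det_neg, h0, mul_zero]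

/-- A symmetric unitary matrix is diagonalized by a real orthogonal matrix. -/
theorem exists_orthogonal_diagonalization {S : Matrix ι ι ℂ} (hS : S ∈ Matrix.unitaryGroup ι ℂ)
    (hS' : Sᵀ = S) : ∃ O : Matrix ι ι ℝ, Oᵀ * O = 1 ∧ ∃ d : ι → ℝ,
      (O.map Complex.ofReal)ᵀ * S * O.map Complex.ofReal =
        Matrix.diagonal fun i => Complex.exp (Complex.I * d i) := by
  obtain ⟨z, hz, hdet⟩ := exists_norm_one_isUnit_one_add_smul S
  have hzz : z * (starRingEnd ℂ) z = 1 := by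
    rw [Complex.mul_conj', hz]
    simp
  have hSS' : Sᴴ * S = 1 := (Matrix.mem_unitaryGroup_iff').1 hS
  set K := z • 1 + S with hK
  have hKi : K * K⁻¹ = 1 := Matrix.mul_nonsing_inv _ hdet
  have hKi' : K⁻¹ * K = 1 := Matrix.nonsing_inv_mul _ hdet
  set M := z • 1 - S with hM
  have hKM : K * M = M * K := by
    simp only [hK, hM, Matrix.add_mul, Matrix.mul_sub, Matrix.sub_mul, Matrix.mul_add]
    simp
    abel
  have hKM' : K⁻¹ * M = M * K⁻¹ := by
    calc K⁻¹ * M = K⁻¹ * (M * K) * K⁻¹ := by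
          rw [Matrix.mul_assoc, Matrix.mul_assoc, hKi, Matrix.mul_one]
      _ = M * K⁻¹ := by rw [← hKM, ← Matrix.mul_assoc, hKi', Matrix.one_mul]
  -- The Cayley transform of `S` is symmetric and Hermitian, hence real symmetric, and the real
  -- spectral theorem applies.
  set H := Complex.I • (M * K⁻¹) with hH
  have hHK : H * K = Complex.I • M := by
    rw [hH, Matrix.smul_mul, Matrix.mul_assoc, hKi', Matrix.mul_one]
  have hHt : Hᵀ = H := by
    have hKt : Kᵀ = K := by simp [hK, hS']
    have hMt : Mᵀ = M := by simp [hM, hS']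
    rw [hH, Matrix.transpose_smul, Matrix.transpose_mul, Matrix.transpose_nonsing_inv, hKt, hMt,
      hKM']
  have hHh : Hᴴ = H := by
    -- Conjugating by the invertible `K` removes the inverse, leaving an identity that uses only
    -- that `S` is unitary and |z| = 1.
    have h1 : Kᴴ * H * K = Kᴴ * Hᴴ * K := by
      rw [← Matrix.conjTranspose_mul, hHK, Matrix.mul_assoc, hHK]
      simp only [hK, hM, Matrix.conjTranspose_smul, Matrix.conjTranspose_add,
        Matrix.conjTranspose_sub, Matrix.conjTranspose_one, Matrix.add_mul, Matrix.mul_add,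
        Matrix.mul_sub, Matrix.sub_mul, Matrix.smul_mul, Matrix.mul_smul, Matrix.one_mul,
        Matrix.mul_one, hSS', Complex.star_def, Complex.conj_I]
      match_scalars <;> first
        | ring1
        | linear_combination (2 * Complex.I) * hzz
    have hdet' : IsUnit (Kᴴ).det := by
      rw [Matrix.det_conjTranspose]
      exact hdet.star
    have h2 := congrArg (fun X => (Kᴴ)⁻¹ * X * K⁻¹) h1
    simp only [Matrix.mul_assoc, hKi, Matrix.mul_one] at h2
    rw [← Matrix.mul_assoc, ← Matrix.mul_assoc, Matrix.nonsing_inv_mul _ hdet', Matrix.one_mul,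
      Matrix.one_mul] at h2
    exact h2.symm
  obtain ⟨R, hR⟩ := exists_map_ofReal_eq (hHh.trans hHt.symm)
  have hRs : R.IsHermitian := by
    ext i j
    have := congrFun (congrFun hHt i) j
    rw [← hR] at this
    simpa using this
  set O : Matrix ι ι ℝ := (hRs.eigenvectorUnitary : Matrix ι ι ℝ) with hO
  have hOO : Oᵀ * O = 1 := by
    have := (Matrix.mem_unitaryGroup_iff').1 hRs.eigenvectorUnitary.2
    rwa [Matrix.star_eq_conjTranspose, Matrix.conjTranspose_eq_transpose_of_trivial] at this
  have hRd : Oᵀ * R * O = Matrix.diagonal hRs.eigenvalues := by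
    have h := hRs.conjStarAlgAut_star_eigenvectorUnitary
    rw [Unitary.conjStarAlgAut_star_apply] at h
    rw [Matrix.star_eq_conjTranspose, Matrix.conjTranspose_eq_transpose_of_trivial] at h
    exact h
  set l := hRs.eigenvalues with hl
  set Oc := O.map Complex.ofReal with hOc
  have hOOc : Ocᵀ * Oc = 1 := by
    rw [hOc, ← Matrix.transpose_map, ← map_ofReal_mul, hOO]
    simp
  have hOOc' : Oc * Ocᵀ = 1 := mul_eq_one_comm.1 hOOc
  have hHd : Ocᵀ * H * Oc = Matrix.diagonal fun i => (l i : ℂ) := by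
    rw [hOc, ← hR, ← Matrix.transpose_map, ← map_ofReal_mul, ← map_ofReal_mul, hRd,
      Matrix.diagonal_map Complex.ofReal_zero]
  set X := Ocᵀ * S * Oc with hX
  have hne : ∀ i, (l i : ℂ) + Complex.I ≠ 0 := by
    intro i h0
    have := congrArg Complex.im h0
    simp at this
  -- Inverting the Cayley transform: (H + i)S = z(i - H), so `S` is diagonal in the eigenbasis of
  -- `H`.
  have h1 : (Matrix.diagonal fun i => (l i : ℂ) + Complex.I) * X =
      Matrix.diagonal fun i => z * (Complex.I - l i) := by
    have h2 : H * S + Complex.I • S = (z * Complex.I) • 1 - z • H := by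
      have h3 := hHK
      rw [hK, hM, Matrix.mul_add, Matrix.mul_smul, Matrix.mul_one] at h3
      have h4 : H * S = Complex.I • (z • 1 - S) - z • H := by
        rw [← h3]
        abel
      rw [h4]
      module
    have h5 : (Matrix.diagonal fun i => (l i : ℂ) + Complex.I) = Ocᵀ * H * Oc + Complex.I • 1 := by
      rw [hHd, ← Matrix.diagonal_one, ← Matrix.diagonal_smul, Matrix.diagonal_add]
      congr 1
      funext i
      simp
    have h6 : (Matrix.diagonal fun i => z * (Complex.I - l i)) =
        (z * Complex.I) • 1 - z • (Ocᵀ * H * Oc) := by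
      rw [hHd, ← Matrix.diagonal_one, ← Matrix.diagonal_smul, ← Matrix.diagonal_smul,
        Matrix.diagonal_sub]
      congr 1
      funext i
      simp
      ring
    have h7 := congrArg (fun X => Ocᵀ * X * Oc) h2
    simp only [Matrix.mul_add, Matrix.add_mul, Matrix.mul_sub, Matrix.sub_mul, Matrix.mul_smul,
      Matrix.smul_mul, Matrix.mul_one, hOOc] at h7
    rw [h5, h6, ← h7, Matrix.add_mul, Matrix.smul_mul, Matrix.one_mul, hX]
    congr 1
    simp only [Matrix.mul_assoc]
    rw [← Matrix.mul_assoc Oc Ocᵀ, hOOc', Matrix.one_mul]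
  have hXd : X = Matrix.diagonal fun i => z * (Complex.I - l i) / ((l i : ℂ) + Complex.I) := by
    ext i j
    have h2 := congrFun (congrFun h1 i) j
    rw [Matrix.diagonal_mul] at h2
    rcases eq_or_ne i j with rfl | hij
    · rw [Matrix.diagonal_apply_eq] at h2 ⊢
      rw [eq_div_iff (hne i), mul_comm, h2]
    · rw [Matrix.diagonal_apply_ne _ hij] at h2 ⊢
      exact (mul_eq_zero.1 h2).resolve_left (hne i)
  refine ⟨O, hOO, fun i => Complex.arg (z * (Complex.I - l i) / ((l i : ℂ) + Complex.I)), ?_⟩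
  rw [← hOc, ← hX, hXd]
  congr 1
  funext i
  have hn : ‖z * (Complex.I - l i) / ((l i : ℂ) + Complex.I)‖ = 1 := by
    rw [norm_div, norm_mul, hz, one_mul, div_eq_one_iff_eq (norm_ne_zero_iff.2 (hne i))]
    rw [Complex.norm_eq_sqrt_sq_add_sq, Complex.norm_eq_sqrt_sq_add_sq]
    congr 1
    simp
  have := Complex.norm_mul_exp_arg_mul_I (z * (Complex.I - l i) / ((l i : ℂ) + Complex.I))
  rw [hn, Complex.ofReal_one, one_mul, mul_comm] at this
  exact this.symm

/-- A unitary matrix is a product of a real orthogonal, a diagonal and a real orthogonal matrix. -/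
theorem exists_orthogonal_mul_diagonal_mul_orthogonal {U : Matrix ι ι ℂ}
    (hU : U ∈ Matrix.unitaryGroup ι ℂ) :
    ∃ O₁ O₂ : Matrix ι ι ℝ, O₁ᵀ * O₁ = 1 ∧ O₂ᵀ * O₂ = 1 ∧ ∃ d : ι → ℂ, (∀ i, ‖d i‖ = 1) ∧
      U = O₁.map Complex.ofReal * Matrix.diagonal d * (O₂.map Complex.ofReal)ᵀ := by
  have hUU' : Uᴴ * U = 1 := (Matrix.mem_unitaryGroup_iff').1 hU
  have hUt : Uᵀ * Uᵀᴴ = 1 := by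
    have := congrArg Matrix.transpose hUU'
    rw [Matrix.transpose_mul, Matrix.transpose_one] at this
    exact this
  have hS : Uᵀ * U ∈ Matrix.unitaryGroup ι ℂ :=
    mul_mem (Matrix.mem_unitaryGroup_iff.2 hUt) hU
  obtain ⟨O, hO, d, hd⟩ := exists_orthogonal_diagonalization hS (by simp [Matrix.transpose_mul])
  set Oc := O.map Complex.ofReal with hOc
  have hOOc : Ocᵀ * Oc = 1 := by
    rw [hOc, ← Matrix.transpose_map, ← map_ofReal_mul, hO]
    simp
  have hOOc' : Oc * Ocᵀ = 1 := mul_eq_one_comm.1 hOOc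
  have hOch : Ocᴴ = Ocᵀ := by
    ext i j
    simp [hOc]
  set e : ι → ℂ := fun i => Complex.exp (Complex.I * (d i / 2 : ℝ)) with he
  set f : ι → ℂ := fun i => Complex.exp (-(Complex.I * (d i / 2 : ℝ))) with hf
  have hfe : ∀ i, f i * e i = 1 := by
    intro i
    rw [hf, he, ← Complex.exp_add]
    simp
  have hfs : ∀ i, star (f i) = e i := by
    intro i
    rw [hf, he, Complex.star_def, ← Complex.exp_conj, map_neg, map_mul, Complex.conj_I,
      Complex.conj_ofReal, neg_mul, neg_neg]
  have hee : ∀ i, Complex.exp (Complex.I * d i) = e i * e i := by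
    intro i
    rw [he, ← Complex.exp_add]
    congr 1
    push_cast
    ring
  -- Dividing out a square root of the diagonal of UᵀU makes `V` both unitary and complex
  -- orthogonal, so that Vᴴ = Vᵀ and `V` is real.
  set V := U * Oc * Matrix.diagonal f with hV
  have hVh : Vᴴ * V = 1 := by
    have h1 : Vᴴ = Matrix.diagonal e * (Ocᵀ * Uᴴ) := by
      rw [hV, Matrix.conjTranspose_mul, Matrix.conjTranspose_mul, hOch,
        Matrix.diagonal_conjTranspose]
      congr 2
      funext i
      exact hfs i
    rw [h1, hV]
    calc Matrix.diagonal e * (Ocᵀ * Uᴴ) * (U * Oc * Matrix.diagonal f)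
        = Matrix.diagonal e * (Ocᵀ * (Uᴴ * U) * Oc) * Matrix.diagonal f := by
          simp only [Matrix.mul_assoc]
      _ = 1 := by
          rw [hUU', Matrix.mul_one, hOOc, Matrix.mul_one, Matrix.diagonal_mul_diagonal,
            ← Matrix.diagonal_one]
          congr 1
          funext i
          rw [mul_comm, hfe]
  have hVt : Vᵀ * V = 1 := by
    rw [hV, Matrix.transpose_mul, Matrix.transpose_mul, Matrix.diagonal_transpose]
    calc Matrix.diagonal f * (Ocᵀ * Uᵀ) * (U * Oc * Matrix.diagonal f)
        = Matrix.diagonal f * (Ocᵀ * (Uᵀ * U) * Oc) * Matrix.diagonal f := by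
          simp only [Matrix.mul_assoc]
      _ = 1 := by
          rw [hd, Matrix.diagonal_mul_diagonal, Matrix.diagonal_mul_diagonal,
            ← Matrix.diagonal_one]
          congr 1
          funext i
          rw [hee]
          linear_combination (f i * e i + 1) * hfe i
  obtain ⟨R, hR⟩ : ∃ R : Matrix ι ι ℝ, R.map Complex.ofReal = V := by
    refine exists_map_ofReal_eq ?_
    have h1 : V * Vᴴ = 1 := mul_eq_one_comm.1 hVh
    calc Vᴴ = Vᵀ * V * Vᴴ := by rw [hVt, Matrix.one_mul]
      _ = Vᵀ := by rw [Matrix.mul_assoc, h1, Matrix.mul_one]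
  refine ⟨R, O, ?_, hO, e, fun i => ?_, ?_⟩
  · refine Matrix.map_injective Complex.ofReal_injective ?_
    change (Rᵀ * R).map Complex.ofReal = _
    rw [map_ofReal_mul, Matrix.transpose_map, hR, hVt]
    simp
  · change ‖Complex.exp (Complex.I * (d i / 2 : ℝ))‖ = 1
    rw [mul_comm]
    exact Complex.norm_exp_ofReal_mul_I _
  · rw [hR, ← hOc, hV, Matrix.mul_assoc _ (Matrix.diagonal f), Matrix.diagonal_mul_diagonal]
    simp only [hfe]
    rw [Matrix.diagonal_one, Matrix.mul_one, Matrix.mul_assoc, hOOc', Matrix.mul_one]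

end SymmetricUnitary

end

/-! ### Magic basis and the canonical decomposition. -/

noncomputable section

/-- The matrix with columns `1`, `i X`, `i Y`, `i Z` (the magic basis, up to normalization). -/
def magic : Matrix (Qubit × Qubit) (Fin 4) ℂ := Matrix.of fun x μ =>
  ![(1 : Matrix Qubit Qubit ℂ), Complex.I • pauliX, Complex.I • pauliY, Complex.I • pauliZ] μ
    x.1 x.2

/-- Quaternion conjugation in the magic basis. -/
def magicConj : Matrix (Fin 4) (Fin 4) ℝ := Matrix.diagonal ![1, -1, -1, -1]

/-- The `2 × 2` matrix of a quaternion. -/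
def quatMatrix (v : Fin 4 → ℝ) : Matrix Qubit Qubit ℂ :=
  !![v 0 + Complex.I * v 3, v 2 + Complex.I * v 1; -v 2 + Complex.I * v 1, v 0 - Complex.I * v 3]

/-- The reflection in the hyperplane orthogonal to the unit vector `v`. -/
def householder (v : Fin 4 → ℝ) : Matrix (Fin 4) (Fin 4) ℝ := 1 - (2 : ℝ) • Matrix.vecMulVec v v

theorem magic_conjTranspose_mul : magicᴴ * magic = (2 : ℂ) • 1 := by
  ext i j
  fin_cases i <;> fin_cases j <;>
    simp [magic, Matrix.mul_apply, Fintype.sum_prod_type, pauliX, pauliY, pauliZ] <;> norm_num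

theorem magic_mul_conjTranspose : magic * magicᴴ = (2 : ℂ) • 1 := by
  ext ⟨i, k⟩ ⟨j, l⟩
  fin_cases i <;> fin_cases j <;> fin_cases k <;> fin_cases l <;>
    simp [magic, Matrix.mul_apply, Fin.sum_univ_four, pauliX, pauliY, pauliZ] <;>
    norm_num

theorem quatMatrix_mem_unitaryGroup {v : Fin 4 → ℝ} (hv : ∑ μ, v μ ^ 2 = 1) :
    quatMatrix v ∈ Matrix.unitaryGroup Qubit ℂ := by
  rw [Fin.sum_univ_four] at hv
  have hv' : (v 0 : ℂ) ^ 2 + (v 1 : ℂ) ^ 2 + (v 2 : ℂ) ^ 2 + (v 3 : ℂ) ^ 2 = 1 := by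
    exact_mod_cast hv
  have hI := Complex.I_mul_I
  rw [Matrix.mem_unitaryGroup_iff, Matrix.star_eq_conjTranspose]
  ext i j
  fin_cases i <;> fin_cases j <;> simp [quatMatrix, Matrix.mul_apply]
  · linear_combination hv' - ((v 1 : ℂ) ^ 2 + (v 3 : ℂ) ^ 2) * hI
  · ring
  · ring
  · linear_combination hv' - ((v 1 : ℂ) ^ 2 + (v 3 : ℂ) ^ 2) * hI

/-- For a unit quaternion v the reflection is x ↦ -v x̄ v, and A⊗Bᵀ acts on the matrix X as AXB. -/
theorem magic_mul_householder {v : Fin 4 → ℝ} (hv : ∑ μ, v μ ^ 2 = 1) :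
    magic * (householder v).map Complex.ofReal =
      (-quatMatrix v ⊗ₖ (quatMatrix v)ᵀ) * magic * magicConj.map Complex.ofReal := by
  rw [Fin.sum_univ_four] at hv
  rw [magicConj, Matrix.diagonal_map Complex.ofReal_zero]
  ext ⟨i, k⟩ μ
  rw [Matrix.mul_diagonal]
  fin_cases i <;> fin_cases k <;> fin_cases μ <;>
    simp [magic, householder, Matrix.mul_apply, Fintype.sum_prod_type, Fin.sum_univ_four,
      Matrix.vecMulVec_apply, Matrix.one_apply, quatMatrix, pauliX, pauliY, pauliZ,
      Complex.ext_iff] <;> (try constructor) <;> linarith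

theorem magicConj_mul_self : magicConj * magicConj = 1 := by
  rw [magicConj, Matrix.diagonal_mul_diagonal, ← Matrix.diagonal_one]
  congr 1
  funext i
  fin_cases i <;> simp

theorem exists_magicConj_mul_householder {v : Fin 4 → ℝ} (hv : ∑ μ, v μ ^ 2 = 1) :
    ∃ w : Fin 4 → ℝ, ∑ μ, w μ ^ 2 = 1 ∧
      magicConj * householder v = householder w * magicConj := by
  refine ⟨magicConj *ᵥ v, ?_, ?_⟩
  · rw [← hv]
    simp [magicConj, Matrix.mulVec_diagonal, Fin.sum_univ_four]
  · ext i j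
    rw [magicConj, Matrix.mul_diagonal, Matrix.diagonal_mul]
    fin_cases i <;> fin_cases j <;>
      simp [householder, Matrix.vecMulVec_apply, Matrix.mulVec_diagonal]

/-- In the magic basis, `R` is a local unitary up to quaternion conjugation. -/
def IsMagicLocal (R : Matrix (Fin 4) (Fin 4) ℝ) : Prop :=
  ∃ L, IsLocalUnitary L ∧ (magic * R.map Complex.ofReal = L * magic ∨
    magic * R.map Complex.ofReal = L * magic * magicConj.map Complex.ofReal)

theorem IsMagicLocal.one : IsMagicLocal 1 :=
  ⟨1, .one, Or.inl (by simp)⟩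

theorem IsMagicLocal.mul_householder {R : Matrix (Fin 4) (Fin 4) ℝ} (hR : IsMagicLocal R)
    {v : Fin 4 → ℝ} (hv : ∑ μ, v μ ^ 2 = 1) : IsMagicLocal (R * householder v) := by
  have hloc : ∀ {v : Fin 4 → ℝ}, ∑ μ, v μ ^ 2 = 1 →
      IsLocalUnitary (-quatMatrix v ⊗ₖ (quatMatrix v)ᵀ) := by
    intro v hv
    have h := quatMatrix_mem_unitaryGroup hv
    refine ⟨-quatMatrix v, ?_, (quatMatrix v)ᵀ, ?_, by ext; simp⟩
    · rw [Matrix.mem_unitaryGroup_iff] at h ⊢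
      rwa [star_neg, neg_mul_neg]
    · rw [Matrix.mem_unitaryGroup_iff'] at h
      rw [Matrix.mem_unitaryGroup_iff]
      have h1 := congrArg Matrix.transpose h
      rw [Matrix.transpose_mul, Matrix.transpose_one] at h1
      exact h1
  obtain ⟨L, hL, h | h⟩ := hR
  · refine ⟨L * _, hL.mul (hloc hv), Or.inr ?_⟩
    rw [map_ofReal_mul, ← Matrix.mul_assoc, h, Matrix.mul_assoc, magic_mul_householder hv]
    simp only [Matrix.mul_assoc]
  · obtain ⟨w, hw, hvw⟩ := exists_magicConj_mul_householder hv
    refine ⟨L * _, hL.mul (hloc hw), Or.inl ?_⟩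
    rw [map_ofReal_mul, ← Matrix.mul_assoc, h, Matrix.mul_assoc, ← map_ofReal_mul, hvw,
      map_ofReal_mul, Matrix.mul_assoc, ← Matrix.mul_assoc magic, magic_mul_householder hw,
      Matrix.mul_assoc _ (magicConj.map _), ← map_ofReal_mul, magicConj_mul_self]
    simp [Matrix.mul_assoc]

/-- By Cartan–Dieudonné, `R` is a product of reflections. Each is local up to one quaternion
conjugation, and conjugations move past reflections and cancel in pairs. -/
theorem isMagicLocal_of_orthogonal {R : Matrix (Fin 4) (Fin 4) ℝ} (hR : Rᵀ * R = 1) :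
    IsMagicLocal R := by
  have hprod : ∀ l : List (EuclideanSpace ℝ (Fin 4)), ∃ R' : Matrix (Fin 4) (Fin 4) ℝ,
      IsMagicLocal R' ∧ ∀ x, (l.map fun v => (ℝ ∙ v)ᗮ.reflection).prod x =
        Matrix.toEuclideanCLM (n := Fin 4) (𝕜 := ℝ) R' x := by
    intro l
    induction l using List.reverseRecOn with
    | nil => exact ⟨1, .one, fun x => by simp⟩
    | append_singleton l v ih =>
      obtain ⟨R', hR', h⟩ := ih
      have happ : ∀ x, ((l ++ [v]).map fun v => (ℝ ∙ v)ᗮ.reflection).prod x =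
          Matrix.toEuclideanCLM (n := Fin 4) (𝕜 := ℝ) R' ((ℝ ∙ v)ᗮ.reflection x) := by
        intro x
        rw [List.map_append, List.prod_append, ← h]
        simp
      have hrefl : ∀ x, (ℝ ∙ v)ᗮ.reflection x =
          x - (2 * (inner ℝ v x / ‖v‖ ^ 2)) • v := by
        intro x
        rw [Submodule.reflection_orthogonal_apply, Submodule.reflection_singleton_apply, neg_sub,
          mul_smul, ← Nat.cast_smul_eq_nsmul ℝ]
        simp
      -- The list may contain the zero vector, whose reflection is the identity.
      rcases eq_or_ne v 0 with rfl | hv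
      · refine ⟨R', hR', fun x => ?_⟩
        rw [happ, hrefl]
        simp
      · have hn : ‖v‖ ≠ 0 := norm_ne_zero_iff.2 hv
        have hns : ∑ μ, v μ ^ 2 = ‖v‖ ^ 2 := by
          rw [EuclideanSpace.norm_sq_eq]
          simp
        have hw : ∑ μ, (v μ / ‖v‖) ^ 2 = 1 := by
          simp only [div_pow]
          rw [← Finset.sum_div, hns, div_self (pow_ne_zero 2 hn)]
        refine ⟨_, hR'.mul_householder hw, fun x => ?_⟩
        rw [happ, hrefl, map_mul]
        change _ = Matrix.toEuclideanCLM (n := Fin 4) (𝕜 := ℝ) R'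
          (Matrix.toEuclideanCLM (n := Fin 4) (𝕜 := ℝ) _ x)
        congr 1
        ext i
        simp only [PiLp.sub_apply, PiLp.smul_apply, smul_eq_mul, Matrix.ofLp_toEuclideanCLM,
          householder, Matrix.sub_mulVec, Matrix.one_mulVec, Matrix.smul_mulVec,
          Matrix.vecMulVec_mulVec, Pi.sub_apply, Pi.smul_apply, PiLp.inner_apply, dotProduct,
          Fin.sum_univ_four]
        simp
        field_simp
  have hT : Matrix.toEuclideanCLM (n := Fin 4) (𝕜 := ℝ) R ∈
      unitary (EuclideanSpace ℝ (Fin 4) →L[ℝ] EuclideanSpace ℝ (Fin 4)) := by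
    have h1 : star R * R = 1 := hR
    rw [Unitary.mem_iff, ← map_star, ← map_mul, ← map_mul, h1, mul_eq_one_comm.1 h1, map_one]
    exact ⟨rfl, rfl⟩
  obtain ⟨l, _, hl⟩ := (Unitary.linearIsometryEquiv ⟨_, hT⟩).reflections_generate_dim
  obtain ⟨R', hR', h⟩ := hprod l
  have : R = R' := by
    refine (Matrix.toEuclideanCLM (n := Fin 4) (𝕜 := ℝ)).injective ?_
    refine ContinuousLinearMap.ext fun x => ?_
    change Matrix.toEuclideanCLM (n := Fin 4) (𝕜 := ℝ) R x =
      Matrix.toEuclideanCLM (n := Fin 4) (𝕜 := ℝ) R' x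
    rw [← h, ← hl]
    rfl
  rwa [this]

theorem pauliGate_mul_magic {P : Matrix Qubit Qubit ℂ} {s : Fin 4 → ℝ} (hs : ∀ μ, s μ ^ 2 = 1)
    (h : (P ⊗ₖ P) * magic = magic * Matrix.diagonal fun μ => (s μ : ℂ)) (β : ℝ) :
    pauliGate P β * magic =
      magic * Matrix.diagonal fun μ => Complex.exp (Complex.I * (β * s μ : ℝ)) := by
  have hd : (Matrix.diagonal fun μ => Complex.exp (Complex.I * (β * s μ : ℝ))) =
      (Real.cos β : ℂ) • 1 + (Complex.I * Real.sin β) • Matrix.diagonal fun μ => (s μ : ℂ) := by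
    rw [← Matrix.diagonal_one, ← Matrix.diagonal_smul, ← Matrix.diagonal_smul,
      Matrix.diagonal_add]
    congr 1
    funext μ
    rw [mul_comm, Complex.exp_mul_I]
    rcases mul_self_eq_one_iff.1 ((sq (s μ)).symm.trans (hs μ)) with h | h <;> simp [h] <;> ring
  rw [hd, pauliGate, Matrix.add_mul, Matrix.smul_mul, Matrix.smul_mul, h, Matrix.mul_add,
    Matrix.mul_smul, Matrix.mul_smul, Matrix.one_mul, Matrix.mul_one]

/-- Diagonal unitaries in the magic basis are the canonical two-qubit gates. -/
theorem exists_canonical_of_diagonal {d : Fin 4 → ℂ} (hd : ∀ μ, ‖d μ‖ = 1) :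
    ∃ (z : ℂ) (α β γ : ℝ), ‖z‖ = 1 ∧ magic * Matrix.diagonal d =
      z • (pauliGate pauliY γ * pauliGate pauliX β * pauliGate pauliZ α * magic) := by
  have hX : (pauliX ⊗ₖ pauliX) * magic =
      magic * Matrix.diagonal fun μ => ((![1, 1, -1, -1] : Fin 4 → ℝ) μ : ℂ) := by
    ext ⟨i, k⟩ μ
    rw [Matrix.mul_diagonal]
    fin_cases i <;> fin_cases k <;> fin_cases μ <;>
      simp [magic, Matrix.mul_apply, Fintype.sum_prod_type, pauliX, pauliY, pauliZ]
  have hY : (pauliY ⊗ₖ pauliY) * magic =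
      magic * Matrix.diagonal fun μ => ((![-1, 1, -1, 1] : Fin 4 → ℝ) μ : ℂ) := by
    ext ⟨i, k⟩ μ
    rw [Matrix.mul_diagonal]
    fin_cases i <;> fin_cases k <;> fin_cases μ <;>
      simp [magic, Matrix.mul_apply, Fintype.sum_prod_type, pauliX, pauliY, pauliZ]
  have hZ : (pauliZ ⊗ₖ pauliZ) * magic =
      magic * Matrix.diagonal fun μ => ((![1, -1, -1, 1] : Fin 4 → ℝ) μ : ℂ) := by
    ext ⟨i, k⟩ μ
    rw [Matrix.mul_diagonal]
    fin_cases i <;> fin_cases k <;> fin_cases μ <;>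
      simp [magic, Matrix.mul_apply, Fintype.sum_prod_type, pauliX, pauliY, pauliZ]
  set θ : Fin 4 → ℝ := fun μ => (d μ).arg with hθ
  have hdθ : ∀ μ, d μ = Complex.exp (Complex.I * θ μ) := by
    intro μ
    have := Complex.norm_mul_exp_arg_mul_I (d μ)
    rw [hd, Complex.ofReal_one, one_mul, mul_comm] at this
    exact this.symm
  -- The spectra of 1, X⊗X, Y⊗Y and Z⊗Z in the magic basis are the columns of a 4 × 4 Hadamard
  -- matrix, so any four phases are matched by taking inner products divided by 4.
  refine ⟨Complex.exp (((θ 0 + θ 1 + θ 2 + θ 3) / 4 : ℝ) * Complex.I),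
    (θ 0 - θ 1 - θ 2 + θ 3) / 4, (θ 0 + θ 1 - θ 2 - θ 3) / 4, (-θ 0 + θ 1 - θ 2 + θ 3) / 4,
    Complex.norm_exp_ofReal_mul_I _, ?_⟩
  rw [Matrix.mul_assoc, pauliGate_mul_magic (by intro μ; fin_cases μ <;> simp) hZ,
    ← Matrix.mul_assoc, Matrix.mul_assoc (pauliGate pauliY _),
    pauliGate_mul_magic (by intro μ; fin_cases μ <;> simp) hX,
    ← Matrix.mul_assoc, pauliGate_mul_magic (by intro μ; fin_cases μ <;> simp) hY,
    Matrix.mul_assoc, Matrix.mul_assoc, Matrix.diagonal_mul_diagonal, Matrix.diagonal_mul_diagonal,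
    ← Matrix.mul_smul, ← Matrix.diagonal_smul]
  congr 2
  funext μ
  simp only [Pi.smul_apply, smul_eq_mul, ← Complex.exp_add, hdθ]
  congr 1
  fin_cases μ <;> simp <;> ring

/-- The canonical decomposition of two-qubit unitaries. -/
theorem exists_canonical_decomposition {U : Matrix (Qubit × Qubit) (Qubit × Qubit) ℂ}
    (hU : U ∈ Matrix.unitaryGroup (Qubit × Qubit) ℂ) :
    ∃ (z : ℂ) (α β γ : ℝ) (L M : Matrix (Qubit × Qubit) (Qubit × Qubit) ℂ), ‖z‖ = 1 ∧
      IsLocalUnitary L ∧ IsLocalUnitary M ∧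
      U = z • (L * (pauliGate pauliY γ * pauliGate pauliX β * pauliGate pauliZ α * M)) := by
  have hUU : Uᴴ * U = 1 := (Matrix.mem_unitaryGroup_iff').1 hU
  set V := (1 / 2 : ℂ) • (magicᴴ * U * magic) with hV
  have hVu : V ∈ Matrix.unitaryGroup (Fin 4) ℂ := by
    rw [Matrix.mem_unitaryGroup_iff', Matrix.star_eq_conjTranspose, hV, Matrix.conjTranspose_smul,
      Matrix.smul_mul, Matrix.mul_smul, smul_smul]
    have : (magicᴴ * U * magic)ᴴ * (magicᴴ * U * magic) = (4 : ℂ) • 1 := by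
      calc (magicᴴ * U * magic)ᴴ * (magicᴴ * U * magic)
          = magicᴴ * Uᴴ * (magic * magicᴴ) * U * magic := by
            simp only [Matrix.conjTranspose_mul, Matrix.conjTranspose_conjTranspose,
              Matrix.mul_assoc]
        _ = (4 : ℂ) • 1 := by
            rw [magic_mul_conjTranspose, Matrix.mul_smul, Matrix.mul_one, Matrix.smul_mul,
              Matrix.mul_assoc magicᴴ, hUU, Matrix.mul_one, Matrix.smul_mul,
              magic_conjTranspose_mul, smul_smul]
            norm_num
    rw [this, smul_smul]
    norm_num
  obtain ⟨O₁, O₂, hO₁, hO₂, d, hd, hVd⟩ := exists_orthogonal_mul_diagonal_mul_orthogonal hVu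
  have hUV : U = (1 / 2 : ℂ) • (magic * V * magicᴴ) := by
    have : magic * (magicᴴ * U * magic) * magicᴴ = (4 : ℂ) • U := by
      calc magic * (magicᴴ * U * magic) * magicᴴ
          = magic * magicᴴ * U * (magic * magicᴴ) := by simp only [Matrix.mul_assoc]
        _ = (4 : ℂ) • U := by
          rw [magic_mul_conjTranspose, Matrix.smul_mul, Matrix.one_mul, Matrix.mul_smul,
            Matrix.mul_one, smul_smul]
          norm_num
    rw [hV, Matrix.mul_smul, Matrix.smul_mul, this, smul_smul, smul_smul]
    norm_num
  -- A leftover conjugation is a diagonal sign matrix, later absorbed into the diagonal factor;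
  -- determinant -1 needs no separate treatment.
  have hform : ∀ {O : Matrix (Fin 4) (Fin 4) ℝ}, Oᵀ * O = 1 → ∃ L, IsLocalUnitary L ∧
      ∃ s : Fin 4 → ℝ, (∀ μ, |s μ| = 1) ∧
      magic * O.map Complex.ofReal = L * magic * Matrix.diagonal fun μ => (s μ : ℂ) := by
    intro O hO
    obtain ⟨L, hL, h | h⟩ := isMagicLocal_of_orthogonal hO
    · exact ⟨L, hL, fun _ => 1, by simp, by simpa using h⟩
    · refine ⟨L, hL, ![1, -1, -1, -1], fun μ => by fin_cases μ <;> simp, ?_⟩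
      rw [h, magicConj, Matrix.diagonal_map Complex.ofReal_zero]
  obtain ⟨L, hL, s, hs, hLs⟩ := hform hO₁
  obtain ⟨M, hM, t, ht, hMt⟩ := hform hO₂
  have hM' : IsLocalUnitary Mᴴ := by
    obtain ⟨w, hw, v, hv, rfl⟩ := hM
    exact ⟨_, Unitary.star_mem hw, _, Unitary.star_mem hv, Matrix.conjTranspose_kronecker _ _⟩
  have hO₂m : (O₂.map Complex.ofReal)ᵀ * magicᴴ =
      (Matrix.diagonal fun μ => (t μ : ℂ)) * (magicᴴ * Mᴴ) := by
    have h1 : (O₂.map Complex.ofReal)ᵀ = (O₂.map Complex.ofReal)ᴴ := by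
      ext i j
      simp
    rw [h1, ← Matrix.conjTranspose_mul, hMt, Matrix.conjTranspose_mul, Matrix.conjTranspose_mul,
      Matrix.diagonal_conjTranspose]
    congr 2
    funext μ
    simp
  have hd' : ∀ μ, ‖(s μ : ℂ) * d μ * (t μ : ℂ)‖ = 1 := by
    intro μ
    simp [hs, ht, hd]
  obtain ⟨z, α, β, γ, hz, hcan⟩ := exists_canonical_of_diagonal hd'
  refine ⟨z, α, β, γ, L, Mᴴ, hz, hL, hM', ?_⟩
  calc U = (1 / 2 : ℂ) • ((magic * O₁.map Complex.ofReal) * Matrix.diagonal d *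
        ((O₂.map Complex.ofReal)ᵀ * magicᴴ)) := by
        rw [hUV, hVd]
        simp only [Matrix.mul_assoc]
    _ = (1 / 2 : ℂ) • (L * (magic * Matrix.diagonal fun μ => (s μ : ℂ) * d μ * (t μ : ℂ)) *
        (magicᴴ * Mᴴ)) := by
        rw [hLs, hO₂m, ← Matrix.diagonal_mul_diagonal, ← Matrix.diagonal_mul_diagonal]
        simp only [Matrix.mul_assoc]
    _ = _ := by
        rw [hcan, Matrix.mul_smul, Matrix.smul_mul, smul_comm]
        congr 1
        rw [← Matrix.mul_assoc L, Matrix.mul_assoc _ magic, ← Matrix.mul_assoc magic,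
          magic_mul_conjTranspose, Matrix.smul_mul, Matrix.one_mul, Matrix.mul_smul, smul_smul,
          Matrix.mul_assoc]
        norm_num

end

/-! ### From local measurements to LOBC protocols. -/

noncomputable section

section Protocol

variable {n : ℕ}

/-- The operator with the given blocks. -/
def ofBlocks (A : Halves n → Matrix Qubit Qubit ℂ) : Matrix Qubit (Qubit × Halves n) ℂ :=
  Matrix.of fun i x => A x.2 i x.1

theorem ebitsAmp_eq (s t : Halves n) :
    ebitsAmp n s t = if s = t then (1 / (Real.sqrt 2 : ℂ)) ^ n else 0 := by
  unfold ebitsAmp ebitAmp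
  split_ifs with h
  · subst h
    simp
  · obtain ⟨k, hk⟩ := Function.ne_iff.1 h
    exact Finset.prod_eq_zero (Finset.mem_univ k) (if_neg hk)

theorem ofBlocks_kronecker_mul_appendEbits (A B : Halves n → Matrix Qubit Qubit ℂ) :
    (ofBlocks A ⊗ₖ ofBlocks B) * appendEbits n = jointKraus A B := by
  ext ⟨i, j⟩ ⟨k, l⟩
  simp only [Matrix.mul_apply, Matrix.kroneckerMap_apply, ofBlocks, appendEbits, Matrix.of_apply,
    Fintype.sum_prod_type, ebitsAmp_eq, jointKraus, Matrix.smul_apply, Matrix.sum_apply,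
    smul_eq_mul]
  have h : ∀ (x y : Qubit) (s : Halves n), ∑ t, A s i x * B t j y *
      (if x = k ∧ y = l then if s = t then (1 / (Real.sqrt 2 : ℂ)) ^ n else 0 else 0) =
      if x = k ∧ y = l then A s i x * B s j y * (1 / (Real.sqrt 2 : ℂ)) ^ n else 0 := by
    intro x y s
    split_ifs <;> simp
  have h2 : ∀ (x : Qubit) (s : Halves n), ∑ y, ∑ t, A s i x * B t j y *
      (if x = k ∧ y = l then if s = t then (1 / (Real.sqrt 2 : ℂ)) ^ n else 0 else 0) =
      if x = k then A s i x * B s j l * (1 / (Real.sqrt 2 : ℂ)) ^ n else 0 := by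
    intro x s
    simp only [h]
    by_cases hx : x = k <;> simp [hx]
  simp only [h2]
  rw [Finset.sum_comm, Finset.mul_sum]
  refine Finset.sum_congr rfl fun s _ => ?_
  rw [Finset.sum_ite_eq' Finset.univ k, if_pos (Finset.mem_univ k)]
  ring

theorem LocalMeasurement.sum_ofBlocks (A : LocalMeasurement n) :
    ∑ a, (ofBlocks (A.ops a))ᴴ * ofBlocks (A.ops a) = 1 := by
  ext ⟨i, s⟩ ⟨j, t⟩
  have h := congrFun (congrFun (A.complete s t) i) j
  simp only [Matrix.sum_apply, Matrix.mul_apply, Matrix.conjTranspose_apply, ofBlocks,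
    Matrix.of_apply] at h ⊢
  rw [h]
  by_cases hs : s = t <;> simp [hs, Matrix.one_apply]

theorem whiteNoise_eq_of_trace_eq {X Y : Matrix (Qubit × Qubit) (Qubit × Qubit) ℂ}
    (h : X.trace = Y.trace) : whiteNoise X = whiteNoise Y := by
  simp only [whiteNoise, LinearMap.coe_mk, AddHom.coe_mk, h]

theorem trace_unitary_conj {U : Matrix (Qubit × Qubit) (Qubit × Qubit) ℂ}
    (hU : U ∈ Matrix.unitaryGroup (Qubit × Qubit) ℂ)
    (X : Matrix (Qubit × Qubit) (Qubit × Qubit) ℂ) :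
    (U * X * Uᴴ).trace = X.trace := by
  have h : Uᴴ * U = 1 := (Matrix.mem_unitaryGroup_iff').1 hU
  rw [Matrix.trace_mul_comm, ← Matrix.mul_assoc, h, Matrix.one_mul]

theorem smul_mul_mul_smul_conjTranspose (c : ℂ) (K X : Matrix (Qubit × Qubit) (Qubit × Qubit) ℂ) :
    (c • K) * X * (c • K)ᴴ = ((‖c‖ ^ 2 : ℝ) : ℂ) • (K * X * Kᴴ) := by
  rw [Matrix.conjTranspose_smul, Matrix.smul_mul, Matrix.smul_mul, Matrix.mul_smul, smul_smul,
    Complex.star_def, Complex.mul_conj']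
  push_cast
  rfl

/-- Local measurements that achieve `U` give a protocol; on failure, the parties twirl with Pauli
matrices that each of them has chosen at random before. -/
theorem Achieves.exists_protocol {A B : LocalMeasurement n}
    {U : Matrix (Qubit × Qubit) (Qubit × Qubit) ℂ} {p : ℝ} (h : Achieves A B U p)
    (hU : U ∈ Matrix.unitaryGroup (Qubit × Qubit) ℂ) :
    ∃ P : LOBCProtocol n, P.PerformsWithProb U p ∧
      P.channel = (p : ℂ) • unitaryChannel U + ((1 - p : ℝ) : ℂ) • whiteNoise := by
  classical
  obtain ⟨c, hc, hp⟩ := h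
  have hc' : ∀ a b, ∃ w v : Matrix.unitaryGroup Qubit ℂ, c a b = 0 ∨
      jointKraus (A.ops a) (B.ops b) =
        c a b • (((w : Matrix Qubit Qubit ℂ) ⊗ₖ (v : Matrix Qubit Qubit ℂ)) * U) := by
    intro a b
    rcases hc a b with h0 | ⟨L, ⟨w, hw, v, hv, rfl⟩, hK⟩
    · exact ⟨1, 1, Or.inl h0⟩
    · exact ⟨⟨w, hw⟩, ⟨v, hv⟩, Or.inr hK⟩
  choose w v hwv using hc'
  -- The label in `Fin 4` is a private uniform random Pauli index; the factor 1/2 is the square root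
  -- of its probability.
  have hcomp : ∀ A : LocalMeasurement n, ∑ o : A.Out × Fin 4,
      ((1 / 2 : ℂ) • ofBlocks (A.ops o.1))ᴴ * ((1 / 2 : ℂ) • ofBlocks (A.ops o.1)) = 1 := by
    intro A
    rw [Fintype.sum_prod_type, ← A.sum_ofBlocks]
    refine Finset.sum_congr rfl fun a _ => ?_
    simp only [Matrix.conjTranspose_smul, Matrix.smul_mul, Matrix.mul_smul, smul_smul,
      Finset.sum_const, Finset.card_univ, Fintype.card_fin]
    rw [← Nat.cast_smul_eq_nsmul ℂ, smul_smul]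
    norm_num
  let P : LOBCProtocol n :=
    { OutA := A.Out × Fin 4
      OutB := B.Out × Fin 4
      A := fun o => (1 / 2 : ℂ) • ofBlocks (A.ops o.1)
      B := fun o => (1 / 2 : ℂ) • ofBlocks (B.ops o.1)
      complete_A := hcomp A
      complete_B := hcomp B
      W := fun a b => if c a.1 b.1 = 0 then ⟨pauli a.2, pauli_mem_unitaryGroup a.2⟩ else
        star (w a.1 b.1)
      V := fun a b => if c a.1 b.1 = 0 then ⟨pauli b.2, pauli_mem_unitaryGroup b.2⟩ else
        star (v a.1 b.1) }
  have hK : ∀ a b, P.kraus a b = (1 / 4 : ℂ) •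
      (((P.W a b : Matrix Qubit Qubit ℂ) ⊗ₖ (P.V a b : Matrix Qubit Qubit ℂ)) *
        jointKraus (A.ops a.1) (B.ops b.1)) := by
    intro a b
    change (((P.W a b : Matrix Qubit Qubit ℂ) * ((1 / 2 : ℂ) • ofBlocks (A.ops a.1))) ⊗ₖ
      ((P.V a b : Matrix Qubit Qubit ℂ) * ((1 / 2 : ℂ) • ofBlocks (B.ops b.1)))) *
      appendEbits n = _
    rw [Matrix.mul_kronecker_mul, Matrix.smul_kronecker, Matrix.kronecker_smul,
      smul_smul, Matrix.mul_smul, Matrix.smul_mul, Matrix.mul_assoc,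
      ofBlocks_kronecker_mul_appendEbits]
    norm_num
  have hfail : ∀ a r b s, c a b = 0 → P.kraus (a, r) (b, s) =
      (1 / 4 : ℂ) • ((pauli r ⊗ₖ pauli s) * jointKraus (A.ops a) (B.ops b)) := by
    intro a r b s h0
    rw [hK]
    simp [P, h0]
  have hsucc : ∀ a r b s, c a b ≠ 0 → P.kraus (a, r) (b, s) = (1 / 4 * c a b) • U := by
    intro a r b s h0
    rw [hK, (hwv a b).resolve_left h0, Matrix.mul_smul, smul_smul, ← Matrix.mul_assoc,
      ← Matrix.mul_kronecker_mul]
    simp [P, h0]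
  refine ⟨P, ⟨Finset.univ.filter fun o => c o.1.1 o.2.1 ≠ 0, ?_, ?_⟩, ?_⟩
  · rintro ⟨⟨a, r⟩, ⟨b, s⟩⟩ ho
    exact ⟨_, hsucc a r b s (Finset.mem_filter.1 ho).2⟩
  · intro ρ hρ
    have hprob : ∀ a r b s, (if c a b ≠ 0 then P.prob ρ (a, r) (b, s) else 0) =
        1 / 16 * ‖c a b‖ ^ 2 := by
      intro a r b s
      split_ifs with h0
      · rw [LOBCProtocol.prob, hsucc a r b s h0, smul_mul_mul_smul_conjTranspose,
          Matrix.trace_smul, trace_unitary_conj hU, hρ.2, smul_eq_mul, mul_one, Complex.ofReal_re,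
          norm_mul, mul_pow]
        norm_num
      · simp [not_not.1 h0]
    rw [Finset.sum_filter, Fintype.sum_prod_type]
    change ∑ a : A.Out × Fin 4, ∑ b : B.Out × Fin 4, _ = p
    simp only [Fintype.sum_prod_type]
    rw [← hp]
    refine Finset.sum_congr rfl fun a _ => ?_
    simp only [hprob, Finset.sum_const, Finset.card_univ, Fintype.card_fin, nsmul_eq_mul,
      ← Finset.mul_sum]
    push_cast
    ring
  · refine LinearMap.ext fun ρ => ?_
    -- One formula for both cases: on failure `c a b` is zero, and on success the two white-noise
    -- terms cancel. By completeness the middle terms sum to white noise of `ρ`, whatever the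
    -- failure operators are.
    have hterm : ∀ a b, ∑ r, ∑ s, P.kraus (a, r) (b, s) * ρ * (P.kraus (a, r) (b, s))ᴴ =
        ((‖c a b‖ ^ 2 : ℝ) : ℂ) • (U * ρ * Uᴴ) +
          whiteNoise (jointKraus (A.ops a) (B.ops b) * ρ * (jointKraus (A.ops a) (B.ops b))ᴴ) -
          ((‖c a b‖ ^ 2 : ℝ) : ℂ) • whiteNoise ρ := by
      intro a b
      by_cases h0 : c a b = 0
      · set J := jointKraus (A.ops a) (B.ops b) with hJ
        have h1 : ∀ r s, P.kraus (a, r) (b, s) * ρ * (P.kraus (a, r) (b, s))ᴴ =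
            (1 / 16 : ℂ) • ((pauli r ⊗ₖ pauli s) * (J * ρ * Jᴴ) * (pauli r ⊗ₖ pauli s)ᴴ) := by
          intro r s
          rw [hfail a r b s h0, smul_mul_mul_smul_conjTranspose, Matrix.conjTranspose_mul]
          simp only [Matrix.mul_assoc]
          congr 1
          norm_num
        simp only [h1, ← Finset.smul_sum, pauli_twirl, smul_smul, h0]
        norm_num
      · have h1 : whiteNoise (jointKraus (A.ops a) (B.ops b) * ρ *
            (jointKraus (A.ops a) (B.ops b))ᴴ) = ((‖c a b‖ ^ 2 : ℝ) : ℂ) • whiteNoise ρ := by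
          rw [(hwv a b).resolve_left h0, smul_mul_mul_smul_conjTranspose, map_smul]
          congr 1
          exact whiteNoise_eq_of_trace_eq (trace_unitary_conj (mul_mem
            (Matrix.kronecker_mem_unitary (w a b).2 (v a b).2) hU) ρ)
        have h2 : ∀ r s, P.kraus (a, r) (b, s) * ρ * (P.kraus (a, r) (b, s))ᴴ =
            (1 / 16 * ((‖c a b‖ ^ 2 : ℝ) : ℂ)) • (U * ρ * Uᴴ) := by
          intro r s
          rw [hsucc a r b s h0, smul_mul_mul_smul_conjTranspose, norm_mul, mul_pow]
          congr 1
          push_cast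
          norm_num
        rw [h1, add_sub_cancel_right]
        simp only [h2, Finset.sum_const, Finset.card_univ, Fintype.card_fin]
        rw [← Nat.cast_smul_eq_nsmul ℂ, ← Nat.cast_smul_eq_nsmul ℂ, smul_smul, smul_smul]
        congr 1
        push_cast
        ring
    have hwhite : ∑ a, ∑ b, whiteNoise (jointKraus (A.ops a) (B.ops b) * ρ *
        (jointKraus (A.ops a) (B.ops b))ᴴ) = whiteNoise ρ := by
      simp only [← map_sum]
      refine whiteNoise_eq_of_trace_eq ?_
      simp only [Matrix.trace_sum, Matrix.mul_assoc, Matrix.trace_mul_comm (jointKraus _ _)]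
      simp only [← Matrix.trace_sum, ← Matrix.mul_sum]
      rw [sum_jointKraus_conjTranspose_mul, Matrix.mul_one]
    change ∑ a : A.Out × Fin 4, ∑ b : B.Out × Fin 4, P.kraus a b * ρ * (P.kraus a b)ᴴ =
      (p : ℂ) • (U * ρ * Uᴴ) + ((1 - p : ℝ) : ℂ) • whiteNoise ρ
    have hsum : ∑ a : A.Out × Fin 4, ∑ b : B.Out × Fin 4, P.kraus a b * ρ * (P.kraus a b)ᴴ =
        ∑ a, ∑ b, ∑ r, ∑ s, P.kraus (a, r) (b, s) * ρ * (P.kraus (a, r) (b, s))ᴴ := by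
      simp only [Fintype.sum_prod_type]
      exact Finset.sum_congr rfl fun a _ => Finset.sum_comm
    rw [hsum]
    simp only [hterm, Finset.sum_add_distrib, Finset.sum_sub_distrib, ← Finset.sum_smul, hwhite,
      ← Complex.ofReal_sum, hp]
    push_cast
    module

end Protocol

/-! ### Success probability, error and ebit count. -/

theorem exists_protocol_successProb {U : Matrix (Qubit × Qubit) (Qubit × Qubit) ℂ}
    (hU : U ∈ Matrix.unitaryGroup (Qubit × Qubit) ℂ) (N : ℕ) :
    ∃ P : LOBCProtocol (8 * N + 1), P.PerformsWithProb U (successProb N) ∧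
      P.channel = (successProb N : ℂ) • unitaryChannel U +
        ((1 - successProb N : ℝ) : ℂ) • whiteNoise := by
  obtain ⟨z, α, β, γ, L, M, hz, hL, ⟨w, hw, v, hv, rfl⟩, hUd⟩ := exists_canonical_decomposition hU
  obtain ⟨A, B, h⟩ := exists_achieves_canonical α β γ N
  have h2 := (h.precomp hw hv).local_mul hz hL
  rw [← hUd] at h2
  exact h2.exists_protocol hU

theorem one_sub_successProb_pos (N : ℕ) : 0 < 1 - successProb N := by
  have h1 : (1 / 2 : ℝ) ^ N ≤ 1 := pow_le_one₀ (by norm_num) (by norm_num)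
  have h2 : (0 : ℝ) < (1 / 2 : ℝ) ^ N := by positivity
  have h3 : (1 - (1 / 2 : ℝ) ^ N) ^ 3 < 1 := pow_lt_one₀ (by linarith) (by linarith) (by norm_num)
  rw [successProb]
  linarith

theorem one_sub_successProb_le (N : ℕ) : 1 - successProb N ≤ 3 * (1 / 2 : ℝ) ^ N := by
  have h1 : (1 / 2 : ℝ) ^ N ≤ 1 := pow_le_one₀ (by norm_num) (by norm_num)
  have h2 : (0 : ℝ) < (1 / 2 : ℝ) ^ N := by positivity
  rw [successProb]
  nlinarith [mul_nonneg (sq_nonneg ((1 / 2 : ℝ) ^ N)) (sub_nonneg.2 h1),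
    sq_nonneg ((1 / 2 : ℝ) ^ N)]

/-- 6⁸ ≤ 2²¹. The constant is chosen so that 8 · 21/8 + 1 = 22. -/
theorem logb_two_six_le : Real.logb 2 6 ≤ 21 / 8 := by
  have h : Real.logb 2 ((6 : ℝ) ^ 8) ≤ Real.logb 2 ((2 : ℝ) ^ 21) :=
    Real.logb_le_logb_of_le (by norm_num) (by norm_num) (by norm_num)
  rw [Real.logb_pow, Real.logb_pow, Real.logb_self_eq_one (by norm_num)] at h
  norm_num at h
  linarith

theorem ebit_count_le (N : ℕ) : ((8 * N + 1 : ℕ) : ℝ) ≤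
    8 * Real.logb 2 (1 / (2 * (1 - successProb N))) + 22 := by
  have h0 := one_sub_successProb_pos N
  have h1 := one_sub_successProb_le N
  have h2 : Real.logb 2 (2 * (1 - successProb N)) ≤ Real.logb 2 (6 * (1 / 2 : ℝ) ^ N) :=
    Real.logb_le_logb_of_le (by norm_num) (by linarith) (by linarith)
  rw [Real.logb_mul (x := 6) (by norm_num) (by positivity), Real.logb_pow, one_div (2 : ℝ),
    Real.logb_inv,
    Real.logb_self_eq_one (by norm_num)] at h2
  have h3 := logb_two_six_le
  rw [one_div, Real.logb_inv]
  push_cast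
  linarith

theorem diamondNorm_channel_sub_le {n : ℕ} {P : LOBCProtocol n}
    {U : Matrix (Qubit × Qubit) (Qubit × Qubit) ℂ}
    (hU : U ∈ Matrix.unitaryGroup (Qubit × Qubit) ℂ) {p : ℝ} (hp : 0 ≤ 1 - p)
    (h : P.channel = (p : ℂ) • unitaryChannel U + ((1 - p : ℝ) : ℂ) • whiteNoise) :
    diamondNorm (P.channel - unitaryChannel U) ≤ ENNReal.ofReal (2 * (1 - p)) := by
  have h1 : P.channel - unitaryChannel U =
      ((1 - p : ℝ) : ℂ) • (whiteNoise - unitaryChannel U) := by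
    rw [h]
    push_cast
    module
  rw [h1]
  exact diamondNorm_noisy_sub_le hU hp

end

theorem theorem2 (U : Matrix (Qubit × Qubit) (Qubit × Qubit) ℂ)
    (hU : U ∈ Matrix.unitaryGroup (Qubit × Qubit) ℂ) :
    (∀ N : ℕ, ∃ P : LOBCProtocol (8 * N + 1),
      P.PerformsWithProb U (successProb N) ∧
      P.channel = (successProb N : ℂ) • unitaryChannel U +
        ((1 - successProb N : ℝ) : ℂ) • whiteNoise ∧
      diamondNorm (P.channel - unitaryChannel U) ≤
        ENNReal.ofReal (2 * (1 - successProb N)) ∧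
      ((8 * N + 1 : ℕ) : ℝ) ≤
        8 * Real.logb 2 (1 / (2 * (1 - successProb N))) + 22) ∧
    (∀ ε : ℝ, 0 < ε → ε ≤ 2 → ∃ n : ℕ,
      (n : ℝ) ≤ 8 * Real.logb 2 (1 / ε) + 30 ∧
      ∃ P : LOBCProtocol n,
        diamondNorm (P.channel - unitaryChannel U) ≤ ENNReal.ofReal ε) := by
  refine ⟨fun N => ?_, fun ε hε hε2 => ?_⟩
  · obtain ⟨P, hP, hch⟩ := exists_protocol_successProb hU N
    exact ⟨P, hP, hch, diamondNorm_channel_sub_le hU (one_sub_successProb_pos N).le hch,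
      ebit_count_le N⟩
  · have hlog : Real.logb 2 (6 / ε) = Real.logb 2 6 + Real.logb 2 (1 / ε) := by
      rw [← Real.logb_mul (by norm_num) (by positivity), mul_one_div]
    have hlog0 : 0 ≤ Real.logb 2 (6 / ε) :=
      Real.logb_nonneg (by norm_num) (by rw [le_div_iff₀ hε]; linarith)
    -- The least N with 6·2^{-N} ≤ ε; rounding up costs at most 8 more ebits, whence 22 + 8 = 30.
    set N := ⌈Real.logb 2 (6 / ε)⌉₊ with hN
    have hN1 : (N : ℝ) < Real.logb 2 (6 / ε) + 1 := Nat.ceil_lt_add_one hlog0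
    have hN2 : Real.logb 2 (6 / ε) ≤ N := Nat.le_ceil _
    obtain ⟨P, -, hch⟩ := exists_protocol_successProb hU N
    refine ⟨8 * N + 1, ?_, P, (diamondNorm_channel_sub_le hU (one_sub_successProb_pos N).le
      hch).trans (ENNReal.ofReal_le_ofReal ?_)⟩
    · have := logb_two_six_le
      push_cast
      linarith
    · have h1 := one_sub_successProb_le N
      have h2 : 6 / ε ≤ 2 ^ N := by
        have := (Real.logb_le_iff_le_rpow (by norm_num) (by positivity)).1 hN2
        rwa [Real.rpow_natCast] at this
      have h3 : 6 * (1 / 2 : ℝ) ^ N ≤ ε := by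
        rw [one_div, inv_pow, ← div_eq_mul_inv, div_le_iff₀ (by positivity)]
        rwa [div_le_iff₀ hε, mul_comm] at h2
      linarith
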